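/- Let $\operatorname{rect}^{\{1\}}=\mathbf 1_{[-1/2,1/2]}$ and, for integers $p\ge 2$, $\operatorname{rect}^{\{p\}}(x)=\int_{x-1/2}^{x+1/2}\operatorname{rect}^{\{p-1\}}(s)\,ds$, the $p$-fold self-convolution of the rectangle function, which is supported in $[-\frac p2,\frac p2]$. For a real-valued $f\in L^2(\mathbb R)$, $f\neq 0$, supported in a compact set $K$, put $\|f\|^2=\int_K|f|^2\,dx$, $\hat f(\omega)=\int_{\mathbb R}e^{-i\omega x}f(x)\,dx$, $$\alpha[f]=\frac1{\|f\|^2}\int_K x|f(x)|^2\,dx,\qquad \sigma_x^2[f]=\frac1{\|f\|^2}\int_K (x-\alpha[f])^2|f(x)|^2\,dx,$$ $$\beta[\hat f]=\frac1{2\pi\|f\|^2}\int_{\mathbb R}\omega|\hat f(\omega)|^2\,d\omega,\qquad \sigma_\omega^2[\hat f]=\frac1{2\pi\|f\|^2}\int_{\mathbb R}(\omega-\beta[\hat f])^2|\hat f(\omega)|^2\,d\omega\in[0,+\infty]$$ (the integral defining $\beta[\hat f]$ converges absolutely for $f=\operatorname{rect}^{\{p\}}$, $p\ge2$), and define the uncertainty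 $U[f]=\sigma_x^2[f]\,\sigma_\omega^2[\hat f]\in[0,+\infty]$. Then $U[\operatorname{rect}^{\{p\}}]$ is strictly decreasing in the integer $p\ge 2$: if $2\le p<q$ are integers, then $U[\operatorname{rect}^{\{q\}}]<U[\operatorname{rect}^{\{p\}}]$. -/

import Mathlib

open MeasureTheory

/-- The squared norm `‖f‖²` of `f` in `L²(K)`. -/
noncomputable def normSqOn (K : Set ℝ) (f : ℝ → ℝ) : ℝ :=
  ∫ x in K, |f x| ^ 2

/-- The Fourier transform `f̂(ω) = ∫ e^{-iωx} f(x) dx`. -/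
noncomputable def fourierHat (f : ℝ → ℝ) (ω : ℝ) : ℂ :=
  ∫ x : ℝ, Complex.exp (-Complex.I * ω * x) * (f x : ℂ)

/-- The space mean `α[f]` of a function `f` supported in `K`. -/
noncomputable def spaceMean (K : Set ℝ) (f : ℝ → ℝ) : ℝ :=
  1 / normSqOn K f * ∫ x in K, x * |f x| ^ 2

/-- The frequency mean `β[f̂]`. -/
noncomputable def freqMean (K : Set ℝ) (f : ℝ → ℝ) : ℝ :=
  1 / (2 * Real.pi * normSqOn K f) * ∫ ω : ℝ, ω * ‖fourierHat f ω‖ ^ 2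

/-- The space variance `σ_x²[f]`. -/
noncomputable def spaceVariance (K : Set ℝ) (f : ℝ → ℝ) : ℝ :=
  1 / normSqOn K f * ∫ x in K, (x - spaceMean K f) ^ 2 * |f x| ^ 2

/-- The frequency variance `σ_ω²[f̂]`, which may be `+∞`; hence the integral is a Lebesgue
integral with values in `[0, +∞]`. -/
noncomputable def freqVariance (K : Set ℝ) (f : ℝ → ℝ) : ENNReal :=
  ENNReal.ofReal (1 / (2 * Real.pi * normSqOn K f)) *
    ∫⁻ ω : ℝ, ENNReal.ofReal ((ω - freqMean K f) ^ 2 * ‖fourierHat f ω‖ ^ 2)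

/-- The uncertainty `U[f] = σ_x²[f] · σ_ω²[f̂]`, with values in `[0, +∞]`. -/
noncomputable def uncertainty (K : Set ℝ) (f : ℝ → ℝ) : ENNReal :=
  ENNReal.ofReal (spaceVariance K f) * freqVariance K f

/-- The `p`-fold self-convolution `rect^{p}` of `rect = 1_[-1/2,1/2]`, for `p ≥ 1`
(the value at `p = 0` is a placeholder). -/
noncomputable def rectConv : ℕ → ℝ → ℝ
  | 0 => fun _ => 0
  | 1 => Set.indicator (Set.Icc (-(1 / 2) : ℝ) (1 / 2)) (fun _ => 1)
  | p + 2 => fun x => ∫ s in (x - 1 / 2)..(x + 1 / 2), rectConv (p + 1) s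

/-- The uncertainty of `rect^{p}`, a function supported in `[-p/2, p/2]`. -/
noncomputable def rectUncertainty (p : ℕ) : ENNReal :=
  uncertainty (Set.Icc (-((p : ℝ) / 2)) ((p : ℝ) / 2)) (rectConv p)

/-! The Fourier transform of `rectConv p` is `sinc (ω/2) ^ p`, both means vanish by parity, and
Parseval gives U = p² J K / I² with I = ∫ sinc^{2p}, J = ∫ sin² sinc^{2p-2}, K = ∫ sinc'²
sinc^{2p-2} (`rectUncertainty_eq`). It suffices to compare p with p + 1, by two different arguments.

For 2 ≤ p < 40 everything is computed. I, J, K are π times rational expressions in values and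
moments of B-splines, which have an explicit truncated-power formula, so U is an explicit rational
number (`uncertainty_eq_rectUncertaintyRat`) and the inequalities are decided by exact arithmetic.

For p ≥ 40, integration by parts gives ∫ sin sinc' sinc^{2p-2} = -I/(2p), so the excess of U over
the Heisenberg bound 1/4 is p² G / (2 I²), where G is twice the Gram determinant of sin·sinc^{p-1}
and sinc'·sinc^{p-1}, a double integral of a nonnegative kernel (`uncertainty_eq_gramIntegral`).
Dilations relate consecutive orders. The Euler product and the partial fractions of the cotangent
give G_{p+1} ≤ c¹⁰ G_p + tail with c² = 1 - 7/(10(p+1)) (`gramIntegral_succ_le`), and I_{p+1} ≥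
√(p/(p+1)) (I_p - tail) (`le_sincI_succ`). To first order in 1/p, (p+1)² c¹⁰ / p² is 1 - 3/2·1/p,
below the factor 1 - 1/p lost by I². The tails are exponentially small while G and I have polynomial
lower bounds (`le_gramIntegral`, `le_sincI`), so the margin survives. -/

open scoped Pointwise

/-! ### The derivative of sinc, decay and integrability -/

/-- The derivative of `Real.sinc`. -/
noncomputable def dsinc (t : ℝ) : ℝ := (Real.cos t - Real.sinc t) / t

lemma sin_eq_mul_sinc (t : ℝ) : Real.sin t = t * Real.sinc t := by
  rcases eq_or_ne t 0 with rfl | ht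
  · simp
  · rw [Real.sinc_of_ne_zero ht]; field_simp

/-- Formally the derivative of sinc t = ∫ cos(2tu) du over [-1/2, 1/2]. At t = 0 the convention x/0
= 0 gives the correct value 0. The formula yields continuity, the bound 1/2, and a sine transform
used later for K. -/
lemma dsinc_eq_integral (t : ℝ) :
    dsinc t = -2 * ∫ u in (-(1 / 2) : ℝ)..(1 / 2), u * Real.sin (2 * t * u) := by
  rcases eq_or_ne t 0 with rfl | ht
  · simp [dsinc]
  have hd : ∀ u : ℝ, HasDerivAt
      (fun u => -u * Real.cos (2 * t * u) / (2 * t) + Real.sin (2 * t * u) / (4 * t ^ 2))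
      (u * Real.sin (2 * t * u)) u := by
    intro u
    have h1 : HasDerivAt (fun u : ℝ => 2 * t * u) (2 * t) u := by
      simpa using (hasDerivAt_id u).const_mul (2 * t)
    have := (((hasDerivAt_id u).neg.mul h1.cos).div_const (2 * t)).add
      (h1.sin.div_const (4 * t ^ 2))
    refine this.congr_deriv ?_
    simp only [Pi.neg_apply, id]
    field_simp
    ring
  rw [intervalIntegral.integral_eq_sub_of_hasDerivAt (fun u _ => hd u)
    (Continuous.intervalIntegrable (by fun_prop) _ _)]
  have e1 : 2 * t * (1 / 2) = t := by ring
  have e2 : 2 * t * -(1 / 2) = -t := by ring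
  rw [e1, e2, Real.cos_neg, Real.sin_neg, dsinc, Real.sinc_of_ne_zero ht]
  field_simp
  ring

lemma continuous_dsinc : Continuous dsinc := by
  have : dsinc = fun t => -2 * ∫ u in (-(1 / 2) : ℝ)..(1 / 2), u * Real.sin (2 * t * u) :=
    funext dsinc_eq_integral
  rw [this]
  refine continuous_const.mul ?_
  exact intervalIntegral.continuous_parametric_intervalIntegral_of_continuous'
    (f := fun t u : ℝ => u * Real.sin (2 * t * u))
    (by fun_prop) _ _

lemma hasDerivAt_sinc (t : ℝ) : HasDerivAt Real.sinc (dsinc t) t := by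
  have key : ∀ t : ℝ, t ≠ 0 → HasDerivAt Real.sinc (dsinc t) t := by
    intro t ht
    have h := (Real.hasDerivAt_sin t).div (hasDerivAt_id t) ht
    have h2 : HasDerivAt Real.sinc _ t := h.congr_of_eventuallyEq (by
      filter_upwards [isOpen_ne.mem_nhds ht] with x hx
      simp [Real.sinc_of_ne_zero hx])
    convert h2 using 1
    rw [dsinc, Real.sinc_of_ne_zero ht]
    simp
    field_simp
  rcases eq_or_ne t 0 with rfl | ht
  · exact hasDerivAt_of_hasDerivAt_of_ne (fun y hy => key y hy)
      Real.continuous_sinc.continuousAt continuous_dsinc.continuousAt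
  · exact key t ht

lemma abs_dsinc_le (t : ℝ) : |dsinc t| ≤ 1 / 2 := by
  rw [dsinc_eq_integral, abs_mul]
  have h : |∫ u in (-(1 / 2) : ℝ)..(1 / 2), u * Real.sin (2 * t * u)| ≤
      ∫ u in (-(1 / 2) : ℝ)..(1 / 2), |u| := by
    refine (intervalIntegral.abs_integral_le_integral_abs (by norm_num)).trans ?_
    refine intervalIntegral.integral_mono_on (by norm_num)
      (Continuous.intervalIntegrable (by fun_prop) _ _)
      (Continuous.intervalIntegrable (by fun_prop) _ _) fun u _ => ?_
    rw [abs_mul]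
    exact mul_le_of_le_one_right (abs_nonneg _) (Real.abs_sin_le_one _)
  have h2 : ∫ u in (-(1 / 2) : ℝ)..(1 / 2), |u| = 1 / 4 := by
    rw [← intervalIntegral.integral_add_adjacent_intervals (b := 0)
      (Continuous.intervalIntegrable (by fun_prop) _ _)
      (Continuous.intervalIntegrable (by fun_prop) _ _)]
    rw [intervalIntegral.integral_congr (g := fun u => -u), intervalIntegral.integral_congr
      (a := 0) (g := fun u => u)]
    · rw [intervalIntegral.integral_neg, integral_id, integral_id]; norm_num
    · intro u hu
      rw [Set.uIcc_of_le (by norm_num)] at hu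
      exact abs_of_nonneg hu.1
    · intro u hu
      rw [Set.uIcc_of_le (by norm_num)] at hu
      exact abs_of_nonpos hu.2
  rw [h2] at h
  norm_num at h ⊢
  linarith

lemma one_add_sq_mul_sinc_sq_le (t : ℝ) : (1 + t ^ 2) * Real.sinc t ^ 2 ≤ 2 := by
  have h1 : Real.sinc t ^ 2 ≤ 1 := (sq_le_one_iff_abs_le_one _).2 (Real.abs_sinc_le_one t)
  have h2 : (t * Real.sinc t) ^ 2 ≤ 1 := by
    rw [← sin_eq_mul_sinc]; exact Real.sin_sq_le_one t
  nlinarith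

lemma sinc_sq_le (t : ℝ) : Real.sinc t ^ 2 ≤ 2 * (1 + t ^ 2)⁻¹ := by
  rw [← div_eq_mul_inv, le_div_iff₀ (by positivity), mul_comm]
  exact one_add_sq_mul_sinc_sq_le t

lemma dsinc_sq_le (t : ℝ) : dsinc t ^ 2 ≤ 5 * (1 + t ^ 2)⁻¹ := by
  rw [← div_eq_mul_inv, le_div_iff₀ (by positivity)]
  have h1 : dsinc t ^ 2 ≤ 1 :=
    (sq_le_one_iff_abs_le_one _).2 ((abs_dsinc_le t).trans (by norm_num))
  have h2 : (t * dsinc t) ^ 2 ≤ 4 := by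
    have : |t * dsinc t| ≤ 2 := by
      rcases eq_or_ne t 0 with rfl | ht
      · simp
      rw [dsinc, mul_div_cancel₀ _ ht]
      exact (abs_sub _ _).trans (by linarith [Real.abs_cos_le_one t, Real.abs_sinc_le_one t])
    nlinarith [abs_le.1 this]
  nlinarith

lemma integrable_of_abs_le {f : ℝ → ℝ} (hf : Continuous f) {C : ℝ}
    (h : ∀ t, |f t| ≤ C * (1 + t ^ 2)⁻¹) : Integrable f :=
  (integrable_inv_one_add_sq.const_mul C).mono' hf.aestronglyMeasurable
    (Filter.Eventually.of_forall h)

lemma abs_sinc_pow_le {n : ℕ} (hn : 2 ≤ n) (t : ℝ) :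
    |Real.sinc t ^ n| ≤ Real.sinc t ^ 2 := by
  rw [abs_pow, ← sq_abs (Real.sinc t)]
  exact pow_le_pow_of_le_one (abs_nonneg _) (Real.abs_sinc_le_one t) hn

lemma integrable_sinc_pow_mul {n : ℕ} (hn : 2 ≤ n) {f : ℝ → ℝ} (hf : Continuous f) {C : ℝ}
    (hC : ∀ t, |f t| ≤ C) : Integrable fun t => Real.sinc t ^ n * f t := by
  have hC0 : 0 ≤ C := (abs_nonneg _).trans (hC 0)
  refine integrable_of_abs_le (C := 2 * C) (by fun_prop) fun t => ?_
  rw [abs_mul]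
  calc _ ≤ Real.sinc t ^ 2 * C :=
        mul_le_mul (abs_sinc_pow_le hn t) (hC t) (abs_nonneg _) (sq_nonneg _)
    _ ≤ 2 * (1 + t ^ 2)⁻¹ * C := by gcongr; exact sinc_sq_le t
    _ = _ := by ring

lemma integrable_sinc_pow {n : ℕ} (hn : 2 ≤ n) : Integrable fun t => Real.sinc t ^ n := by
  simpa using integrable_sinc_pow_mul hn (continuous_const (y := (1 : ℝ))) (C := 1) (by simp)

lemma abs_sinc_mul_dsinc_le (t : ℝ) : |Real.sinc t * dsinc t| ≤ 4 * (1 + t ^ 2)⁻¹ := by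
  rw [abs_mul]
  have h1 := sinc_sq_le t
  have h2 := dsinc_sq_le t
  rw [← sq_abs] at h1 h2
  nlinarith [sq_nonneg (|Real.sinc t| - |dsinc t|)]

lemma integrable_sinc_pow_mul_dsinc_mul {n : ℕ} (hn : 1 ≤ n) {f : ℝ → ℝ} (hf : Continuous f)
    {C : ℝ} (hC : ∀ t, |f t| ≤ C) : Integrable fun t => Real.sinc t ^ n * dsinc t * f t := by
  have hC0 : 0 ≤ C := (abs_nonneg _).trans (hC 0)
  have := continuous_dsinc
  refine integrable_of_abs_le (C := 4 * C) (by fun_prop) fun t => ?_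
  obtain ⟨m, rfl⟩ := Nat.exists_eq_add_of_le' hn
  rw [pow_succ, mul_assoc _ (Real.sinc t), abs_mul, abs_mul]
  calc _ ≤ 1 * (4 * (1 + t ^ 2)⁻¹) * C := by
        gcongr
        · rw [abs_pow]; exact pow_le_one₀ (abs_nonneg _) (Real.abs_sinc_le_one t)
        · exact abs_sinc_mul_dsinc_le t
        · exact hC t
    _ = _ := by ring

lemma integrable_sinc_pow_mul_dsinc_sq (n : ℕ) :
    Integrable fun t => Real.sinc t ^ n * dsinc t ^ 2 := by
  have := continuous_dsinc
  refine integrable_of_abs_le (C := 5) (by fun_prop) fun t => ?_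
  rw [abs_mul, abs_pow, abs_pow (dsinc t), sq_abs]
  calc _ ≤ 1 * dsinc t ^ 2 := by
        gcongr
        exact pow_le_one₀ (abs_nonneg _) (Real.abs_sinc_le_one t)
    _ ≤ _ := by rw [one_mul]; exact dsinc_sq_le t

lemma hasDerivAt_sinc_pow (n : ℕ) (t : ℝ) :
    HasDerivAt (fun t => Real.sinc t ^ n) (n * Real.sinc t ^ (n - 1) * dsinc t) t :=
  (hasDerivAt_sinc t).pow n

/-! ### Convolution powers of rect and their Fourier transforms -/

lemma rectConv_succ_succ (n : ℕ) (x : ℝ) :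
    rectConv (n + 2) x = ∫ s in (x - 1 / 2)..(x + 1 / 2), rectConv (n + 1) s := rfl

lemma rectConv_one : rectConv 1 = Set.indicator (Set.Icc (-(1 / 2) : ℝ) (1 / 2)) (fun _ => 1) := rfl

lemma rectConv_eq_convolution (n : ℕ) :
    (fun x => (rectConv (n + 2) x : ℂ)) =
      convolution (fun x => (rectConv 1 x : ℂ)) (fun x => (rectConv (n + 1) x : ℂ))
        (ContinuousLinearMap.mul ℂ ℂ) volume := by
  ext x
  rw [convolution_def, rectConv_succ_succ]
  have h : ∫ s in (x - 1 / 2)..(x + 1 / 2), rectConv (n + 1) s =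
      ∫ t in (-(1 / 2) : ℝ)..(1 / 2), rectConv (n + 1) (x - t) := by
    rw [intervalIntegral.integral_comp_sub_left (fun s => rectConv (n + 1) s) x, sub_neg_eq_add]
  rw [h, intervalIntegral.integral_of_le (by norm_num), ← integral_Icc_eq_integral_Ioc,
    ← integral_indicator measurableSet_Icc, ← integral_complex_ofReal]
  congr 1
  ext t
  rw [rectConv_one]
  by_cases ht : t ∈ Set.Icc (-(1 / 2) : ℝ) (1 / 2)
  · simp only [Set.indicator_of_mem ht, ContinuousLinearMap.mul_apply', Complex.ofReal_one, one_mul]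
  · simp only [Set.indicator_of_notMem ht, ContinuousLinearMap.mul_apply', Complex.ofReal_zero,
      zero_mul]

lemma integrable_rectConv (n : ℕ) : Integrable (rectConv n) := by
  suffices h : ∀ n, Integrable (fun x => (rectConv (n + 1) x : ℂ)) by
    cases n with
    | zero => exact integrable_zero _ _ _
    | succ n => simpa using (h n).re
  intro n
  have h1 : Integrable (fun x => (rectConv 1 x : ℂ)) := by
    rw [rectConv_one]
    exact ((integrable_indicator_iff measurableSet_Icc).2 (by simp)).ofReal
  induction n with
  | zero => exact h1
  | succ n ih =>
    rw [rectConv_eq_convolution]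
    exact h1.integrable_convolution _ ih

lemma integrable_rectConv_ofReal (n : ℕ) : Integrable (fun x => (rectConv n x : ℂ)) :=
  (integrable_rectConv n).ofReal

lemma continuous_rectConv {n : ℕ} (hn : 2 ≤ n) : Continuous (rectConv n) := by
  obtain ⟨m, rfl⟩ := Nat.exists_eq_add_of_le' hn
  have hi : ∀ a b, IntervalIntegrable (rectConv (m + 1)) volume a b :=
    fun a b => (integrable_rectConv (m + 1)).intervalIntegrable
  have : rectConv (m + 2) = fun x => (∫ s in (0 : ℝ)..(x + 1 / 2), rectConv (m + 1) s) -
      ∫ s in (0 : ℝ)..(x - 1 / 2), rectConv (m + 1) s := by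
    ext x
    rw [intervalIntegral.integral_interval_sub_left (hi _ _) (hi _ _), rectConv_succ_succ]
  rw [this]
  have hc := intervalIntegral.continuous_primitive hi 0
  exact (hc.comp (by fun_prop : Continuous fun x : ℝ => x + 1 / 2)).sub
    (hc.comp (by fun_prop : Continuous fun x : ℝ => x - 1 / 2))

lemma rectConv_neg (n : ℕ) (x : ℝ) : rectConv n (-x) = rectConv n x := by
  match n with
  | 0 => rfl
  | 1 =>
    rw [rectConv_one]
    have : -x ∈ Set.Icc (-(1 / 2) : ℝ) (1 / 2) ↔ x ∈ Set.Icc (-(1 / 2) : ℝ) (1 / 2) := by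
      simp only [Set.mem_Icc]
      constructor <;> rintro ⟨h1, h2⟩ <;> constructor <;> linarith
    by_cases hx : x ∈ Set.Icc (-(1 / 2) : ℝ) (1 / 2)
    · rw [Set.indicator_of_mem hx, Set.indicator_of_mem (this.2 hx)]
    · rw [Set.indicator_of_notMem hx, Set.indicator_of_notMem (mt this.1 hx)]
  | n + 2 =>
    rw [rectConv_succ_succ, rectConv_succ_succ]
    have h := intervalIntegral.integral_comp_neg (fun s => rectConv (n + 1) s)
      (a := x - 1 / 2) (b := x + 1 / 2)
    simp only [rectConv_neg (n + 1)] at h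
    rw [h]
    congr 1 <;> ring

lemma rectConv_eq_zero {n : ℕ} {x : ℝ} (hx : (n : ℝ) / 2 < |x|) : rectConv n x = 0 := by
  match n with
  | 0 => rfl
  | 1 =>
    rw [rectConv_one]
    refine Set.indicator_of_notMem (fun h => ?_) _
    have := abs_le.2 h
    norm_num at hx this
    linarith
  | n + 2 =>
    rw [rectConv_succ_succ, intervalIntegral.integral_congr (g := fun _ => 0)]
    · simp
    · intro s hs
      rw [Set.uIcc_of_le (by linarith)] at hs
      refine rectConv_eq_zero ?_
      push_cast at hx ⊢
      rcases lt_abs.1 hx with h | h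
      · exact lt_abs.2 (Or.inl (by linarith [hs.1]))
      · exact lt_abs.2 (Or.inr (by linarith [hs.2]))

lemma fourierHat_eq_fourier (f : ℝ → ℝ) (ω : ℝ) :
    fourierHat f ω = FourierTransform.fourier (fun x => (f x : ℂ)) (ω / (2 * Real.pi)) := by
  rw [Real.fourier_real_eq_integral_exp_smul, fourierHat]
  congr 1
  ext x
  rw [smul_eq_mul]
  congr 2
  push_cast
  have : (Real.pi : ℂ) ≠ 0 := by exact_mod_cast Real.pi_ne_zero
  field_simp

lemma fourierHat_rectConv_one (ω : ℝ) :
    fourierHat (rectConv 1) ω = (Real.sinc (ω / 2) : ℂ) := by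
  have h1 : fourierHat (rectConv 1) ω =
      ∫ x in (-(1 / 2) : ℝ)..(1 / 2), Complex.exp (((ω * x : ℝ) : ℂ) * Complex.I) := by
    have h2 := intervalIntegral.integral_comp_neg (a := -(1 / 2)) (b := 1 / 2)
      (fun x : ℝ => Complex.exp (((ω * x : ℝ) : ℂ) * Complex.I))
    rw [neg_neg] at h2
    rw [← h2, fourierHat, intervalIntegral.integral_of_le (by norm_num),
      ← integral_Icc_eq_integral_Ioc, ← integral_indicator measurableSet_Icc]
    congr 1
    ext x
    rw [rectConv_one]
    by_cases hx : x ∈ Set.Icc (-(1 / 2) : ℝ) (1 / 2)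
    · rw [Set.indicator_of_mem hx, Set.indicator_of_mem hx]
      push_cast
      rw [mul_one]
      congr 1
      ring
    · rw [Set.indicator_of_notMem hx, Set.indicator_of_notMem hx]
      simp
  rw [h1]
  rcases eq_or_ne ω 0 with rfl | hω
  · norm_num
  have h3 := intervalIntegral.integral_comp_mul_left (a := -(1 / 2)) (b := 1 / 2)
    (fun x : ℝ => Complex.exp ((x : ℂ) * Complex.I)) hω
  rw [h3]
  have e1 : ω * -(1 / 2) = -(ω / 2) := by ring
  have e2 : ω * (1 / 2) = ω / 2 := by ring
  rw [e1, e2, integral_exp_mul_I_eq_sinc, Complex.real_smul]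
  push_cast
  have : (ω : ℂ) ≠ 0 := by exact_mod_cast hω
  field_simp

lemma fourierHat_rectConv {n : ℕ} (hn : 1 ≤ n) (ω : ℝ) :
    fourierHat (rectConv n) ω = ((Real.sinc (ω / 2) ^ n : ℝ) : ℂ) := by
  obtain ⟨m, rfl⟩ := Nat.exists_eq_add_of_le' hn
  induction m with
  | zero => simpa using fourierHat_rectConv_one ω
  | succ m ih =>
    have h := Real.fourier_mul_convolution_eq (integrable_rectConv_ofReal 1)
      (integrable_rectConv_ofReal (m + 1)) (ω / (2 * Real.pi))
    rw [fourierHat_eq_fourier, rectConv_eq_convolution, h, ← fourierHat_eq_fourier, ← fourierHat_eq_fourier, ih (by omega), fourierHat_rectConv_one]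
    push_cast
    ring

/-- Fourier inversion for `rectConv n`, in real form. -/
lemma integral_sinc_pow_mul_cos {n : ℕ} (hn : 2 ≤ n) (x : ℝ) :
    ∫ t : ℝ, Real.sinc t ^ n * Real.cos (2 * t * x) = Real.pi * rectConv n x := by
  have hF : FourierTransform.fourier (fun x => (rectConv n x : ℂ)) =
      fun w : ℝ => ((Real.sinc (Real.pi * w) ^ n : ℝ) : ℂ) := by
    ext w
    have h := fourierHat_rectConv (by omega : 1 ≤ n) (2 * Real.pi * w)
    rw [fourierHat_eq_fourier] at h
    have e1 : 2 * Real.pi * w / (2 * Real.pi) = w := by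
      field_simp
    have e2 : 2 * Real.pi * w / 2 = Real.pi * w := by ring
    rwa [e1, e2] at h
  have hint : Integrable (fun w : ℝ => ((Real.sinc (Real.pi * w) ^ n : ℝ) : ℂ)) :=
    ((integrable_sinc_pow hn).comp_mul_left' Real.pi_ne_zero).ofReal
  have hcont : Continuous (fun x => (rectConv n x : ℂ)) :=
    Complex.continuous_ofReal.comp (continuous_rectConv hn)
  have hinv := hcont.fourierInv_fourier_eq (integrable_rectConv_ofReal n) (by rw [hF]; exact hint)
  have hx := congrFun hinv x
  rw [hF, Real.fourierInv_eq'] at hx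
  have hre := congrArg Complex.re hx
  have hint2 : Integrable (fun v : ℝ => Complex.exp (((2 * Real.pi * inner ℝ v x : ℝ) : ℂ) *
      Complex.I) • ((Real.sinc (Real.pi * v) ^ n : ℝ) : ℂ)) := by
    refine hint.norm.mono' (Continuous.aestronglyMeasurable (by fun_prop)) ?_
    refine Filter.Eventually.of_forall fun v => ?_
    rw [norm_smul, Complex.norm_exp_ofReal_mul_I, one_mul]
  have h3 := integral_re (𝕜 := ℂ) hint2
  simp only [RCLike.re_to_complex] at h3
  rw [← h3, Complex.ofReal_re] at hre
  rw [← hre]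
  have h4 : ∀ v : ℝ, (Complex.exp (((2 * Real.pi * inner ℝ v x : ℝ) : ℂ) *
      Complex.I) • ((Real.sinc (Real.pi * v) ^ n : ℝ) : ℂ)).re =
      (fun t => Real.sinc t ^ n * Real.cos (2 * t * x)) (Real.pi * v) := by
    intro v
    rw [smul_eq_mul, Complex.re_mul_ofReal, Complex.exp_ofReal_mul_I_re, mul_comm]
    simp only [RCLike.inner_apply, conj_trivial]
    congr 2
    ring
  rw [integral_congr_ae (Filter.Eventually.of_forall h4), Measure.integral_comp_mul_left
    (fun t => Real.sinc t ^ n * Real.cos (2 * t * x)), abs_of_pos (by positivity), smul_eq_mul, ← mul_assoc, mul_inv_cancel₀ Real.pi_ne_zero, one_mul]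

lemma integral_rectConv_mul_cos {n : ℕ} (hn : 1 ≤ n) (t : ℝ) :
    ∫ x : ℝ, rectConv n x * Real.cos (2 * t * x) = Real.sinc t ^ n := by
  have h := fourierHat_rectConv hn (2 * t)
  rw [mul_div_cancel_left₀ t two_ne_zero, fourierHat] at h
  have hint : Integrable (fun x : ℝ => Complex.exp (-Complex.I * ((2 * t : ℝ) : ℂ) * x) *
      (rectConv n x : ℂ)) := by
    refine (integrable_rectConv_ofReal n).norm.mono'
      (AEStronglyMeasurable.mul (Continuous.aestronglyMeasurable (by fun_prop))
        (integrable_rectConv_ofReal n).aestronglyMeasurable)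
      (Filter.Eventually.of_forall fun x => ?_)
    rw [norm_mul]
    have : -Complex.I * ((2 * t : ℝ) : ℂ) * x = ((-(2 * t * x) : ℝ) : ℂ) * Complex.I := by
      push_cast; ring
    rw [this, Complex.norm_exp_ofReal_mul_I, one_mul]
  have hre := congrArg Complex.re h
  have h3 := integral_re (𝕜 := ℂ) hint
  simp only [RCLike.re_to_complex] at h3
  rw [← h3, Complex.ofReal_re] at hre
  rw [← hre]
  congr 1
  ext x
  have : -Complex.I * ((2 * t : ℝ) : ℂ) * x = ((-(2 * t * x) : ℝ) : ℂ) * Complex.I := by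
    push_cast; ring
  rw [Complex.re_mul_ofReal, this, Complex.exp_ofReal_mul_I_re, Real.cos_neg, mul_comm]

lemma integrable_id_mul_rectConv (n : ℕ) : Integrable fun x => x * rectConv n x := by
  refine ((integrable_rectConv n).norm.const_mul ((n : ℝ) / 2)).mono'
    (continuous_id.aestronglyMeasurable.mul (integrable_rectConv n).aestronglyMeasurable)
    (Filter.Eventually.of_forall fun x => ?_)
  rw [norm_mul]
  by_cases hx : (n : ℝ) / 2 < |x|
  · simp [rectConv_eq_zero hx]
  · exact mul_le_mul_of_nonneg_right (not_lt.1 hx) (norm_nonneg _)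

/-- Differentiation under the integral sign in the cosine transform of `rectConv n`, dominated
thanks to the compact support. -/
lemma integral_id_mul_rectConv_mul_sin {n : ℕ} (hn : 1 ≤ n) (t : ℝ) :
    ∫ x : ℝ, x * rectConv n x * Real.sin (2 * t * x) =
      -(1 / 2) * (n * Real.sinc t ^ (n - 1) * dsinc t) := by
  have hm := (integrable_rectConv n).aestronglyMeasurable
  have h := (hasDerivAt_integral_of_dominated_loc_of_deriv_le (μ := volume) (𝕜 := ℝ)
    (F := fun t x => rectConv n x * Real.cos (2 * t * x))
    (F' := fun t x => -2 * (x * rectConv n x * Real.sin (2 * t * x)))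
    (bound := fun x => 2 * ‖x * rectConv n x‖) (x₀ := t) (s := Set.univ) Filter.univ_mem
    (Filter.Eventually.of_forall fun t => hm.mul (Continuous.aestronglyMeasurable (by fun_prop)))
    ((integrable_rectConv n).mul_bdd (c := 1) (Continuous.aestronglyMeasurable (by fun_prop))
      (Filter.Eventually.of_forall fun x => Real.abs_cos_le_one _))
    (((integrable_id_mul_rectConv n).aestronglyMeasurable.mul
      (Continuous.aestronglyMeasurable (by fun_prop))).const_mul _)
    (Filter.Eventually.of_forall fun x t _ => by
      rw [norm_mul, norm_mul _ (Real.sin _)]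
      have : ‖(-2 : ℝ)‖ = 2 := by norm_num
      rw [this]
      gcongr
      exact mul_le_of_le_one_right (norm_nonneg _) (Real.abs_sin_le_one _))
    ((integrable_id_mul_rectConv n).norm.const_mul 2)
    (Filter.Eventually.of_forall fun x t _ => by
      have h1 : HasDerivAt (fun t : ℝ => 2 * t * x) (2 * x) t := by
        simpa using ((hasDerivAt_id t).const_mul 2).mul_const x
      refine (h1.cos.const_mul _).congr_deriv ?_
      ring)).2
  have h2 : (fun t => ∫ x, rectConv n x * Real.cos (2 * t * x)) = fun t => Real.sinc t ^ n :=
    funext fun t => integral_rectConv_mul_cos hn t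
  rw [h2] at h
  have h3 := h.unique (hasDerivAt_sinc_pow n t)
  rw [integral_const_mul] at h3
  linarith

/-- Integration by parts in the inversion formula. -/
lemma integral_deriv_sinc_pow_mul_sin {n : ℕ} (hn : 2 ≤ n) (x : ℝ) :
    ∫ t : ℝ, n * Real.sinc t ^ (n - 1) * dsinc t * Real.sin (2 * t * x) =
      -2 * Real.pi * (x * rectConv n x) := by
  have h := integral_mul_deriv_eq_deriv_mul_of_integrable
    (u := fun t => Real.sin (2 * t * x)) (u' := fun t => Real.cos (2 * t * x) * (2 * x))
    (v := fun t => Real.sinc t ^ n) (v' := fun t => n * Real.sinc t ^ (n - 1) * dsinc t)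
    (fun t _ => by
      have h1 : HasDerivAt (fun t : ℝ => 2 * t * x) (2 * x) t := by
        simpa using ((hasDerivAt_id t).const_mul 2).mul_const x
      exact h1.sin)
    (fun t _ => hasDerivAt_sinc_pow n t)
    (by
      have := (integrable_sinc_pow_mul_dsinc_mul (n := n - 1) (by omega)
        (f := fun t => Real.sin (2 * t * x)) (by fun_prop) (C := 1)
        fun t => Real.abs_sin_le_one _).const_mul n
      refine this.congr (Filter.Eventually.of_forall fun t => ?_)
      simp only [Pi.mul_apply]
      ring)
    (by
      have := (integrable_sinc_pow_mul hn (f := fun t => Real.cos (2 * t * x)) (by fun_prop)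
        (C := 1) fun t => Real.abs_cos_le_one _).const_mul (2 * x)
      refine this.congr (Filter.Eventually.of_forall fun t => ?_)
      simp only [Pi.mul_apply]
      ring)
    (by
      have := (integrable_sinc_pow_mul hn (f := fun t => Real.sin (2 * t * x)) (by fun_prop)
        (C := 1) fun t => Real.abs_sin_le_one _)
      refine this.congr (Filter.Eventually.of_forall fun t => ?_)
      simp only [Pi.mul_apply]
      ring)
  calc _ = ∫ t, Real.sin (2 * t * x) * (n * Real.sinc t ^ (n - 1) * dsinc t) := by
        congr 1; ext t; ring
    _ = _ := by
      rw [h]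
      have : (fun t => Real.cos (2 * t * x) * (2 * x) * Real.sinc t ^ n) =
          fun t => 2 * x * (Real.sinc t ^ n * Real.cos (2 * t * x)) := by ext t; ring
      rw [this, integral_const_mul, integral_sinc_pow_mul_cos hn]
      ring

/-! ### The uncertainty in terms of I, J, K -/

/-- `∫ sinc^{2p}`. -/
noncomputable def sincI (p : ℕ) : ℝ := ∫ t : ℝ, Real.sinc t ^ (2 * p)

/-- `∫ sin² sinc^{2p-2}`. -/
noncomputable def sincJ (p : ℕ) : ℝ := ∫ t : ℝ, Real.sin t ^ 2 * Real.sinc t ^ (2 * p - 2)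

/-- `∫ (sinc')² sinc^{2p-2}`. -/
noncomputable def sincK (p : ℕ) : ℝ := ∫ t : ℝ, Real.sinc t ^ (2 * p - 2) * dsinc t ^ 2

/-- Fubini for a bounded kernel. With cosine and sine kernels it plays the role of Parseval's
identity. -/
lemma integral_mul_integral_swap {f h : ℝ → ℝ} {k : ℝ → ℝ → ℝ} (hf : Integrable f)
    (hh : Integrable h) (hk : Continuous (Function.uncurry k)) (hk1 : ∀ x t, |k x t| ≤ 1) :
    ∫ x, f x * ∫ t, h t * k x t = ∫ t, h t * ∫ x, f x * k x t := by
  simp_rw [← integral_const_mul]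
  rw [integral_integral_swap]
  · congr 1
    ext t
    congr 1
    ext x
    ring
  · have h1 := (hf.mul_prod hh).mul_bdd (c := 1) hk.aestronglyMeasurable
      (Filter.Eventually.of_forall fun z => hk1 z.1 z.2)
    refine h1.congr (Filter.Eventually.of_forall fun z => ?_)
    simp only [Function.uncurry]
    ring

lemma integral_eq_zero_of_odd {f : ℝ → ℝ} (hf : ∀ x, f (-x) = -f x) : ∫ x, f x = 0 := by
  have h := integral_neg_eq_self f volume
  simp_rw [hf, integral_neg] at h
  linarith

lemma setIntegral_mul_rectConv_sq (p : ℕ) (w : ℝ → ℝ) :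
    ∫ x in Set.Icc (-((p : ℝ) / 2)) ((p : ℝ) / 2), w x * |rectConv p x| ^ 2 =
      ∫ x, w x * rectConv p x ^ 2 := by
  simp_rw [sq_abs]
  refine setIntegral_eq_integral_of_forall_compl_eq_zero fun x hx => ?_
  rw [rectConv_eq_zero, zero_pow two_ne_zero, mul_zero]
  by_contra h
  exact hx (abs_le.1 (not_lt.1 h))

lemma integral_rectConv_sq {p : ℕ} (hp : 2 ≤ p) :
    ∫ x, rectConv p x ^ 2 = sincI p / Real.pi := by
  have h := integral_mul_integral_swap (integrable_rectConv p) (integrable_sinc_pow hp)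
    (k := fun x t => Real.cos (2 * t * x)) (by fun_prop) fun x t => Real.abs_cos_le_one _
  simp_rw [integral_sinc_pow_mul_cos hp, integral_rectConv_mul_cos (by omega : 1 ≤ p),
    ← pow_add, ← two_mul] at h
  rw [sincI, ← h, eq_div_iff Real.pi_ne_zero, ← integral_mul_const]
  congr 1
  ext x
  ring

/-- Up to constants, x·`rectConv p` and (sinc^p)' are sine transforms of each other, so Parseval
turns the second moment into K. -/
lemma integral_sq_mul_rectConv_sq {p : ℕ} (hp : 2 ≤ p) :
    ∫ x, x ^ 2 * rectConv p x ^ 2 = (p : ℝ) ^ 2 * sincK p / (4 * Real.pi) := by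
  have hi : Integrable fun t => p * Real.sinc t ^ (p - 1) * dsinc t := by
    refine ((integrable_sinc_pow_mul_dsinc_mul (by omega : 1 ≤ p - 1)
      (continuous_const (y := (1 : ℝ))) (C := 1) (by simp)).const_mul p).congr
        (Filter.Eventually.of_forall fun t => ?_)
    simp only
    ring
  have h := integral_mul_integral_swap (integrable_id_mul_rectConv p) hi
    (k := fun x t => Real.sin (2 * t * x)) (by fun_prop) fun x t => Real.abs_sin_le_one _
  simp_rw [integral_deriv_sinc_pow_mul_sin hp,
    integral_id_mul_rectConv_mul_sin (by omega : 1 ≤ p)] at h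
  have h1 : ∫ x, x * rectConv p x * (-2 * Real.pi * (x * rectConv p x)) =
      -2 * Real.pi * ∫ x, x ^ 2 * rectConv p x ^ 2 := by
    rw [← integral_const_mul]
    congr 1
    ext x
    ring
  have h2 : ∫ t, p * Real.sinc t ^ (p - 1) * dsinc t *
      (-(1 / 2) * (p * Real.sinc t ^ (p - 1) * dsinc t)) = -(1 / 2) * (p : ℝ) ^ 2 * sincK p := by
    rw [sincK, ← integral_const_mul]
    congr 1
    ext t
    rw [show 2 * p - 2 = (p - 1) + (p - 1) by omega, pow_add]
    ring
  rw [h1, h2] at h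
  rw [eq_div_iff (by positivity)]
  linarith

lemma sincI_pos {p : ℕ} (hp : 1 ≤ p) : 0 < sincI p := by
  have hnn : ∀ t, 0 ≤ Real.sinc t ^ (2 * p) := fun t => by rw [pow_mul]; positivity
  refine (integral_pos_iff_support_of_nonneg hnn (integrable_sinc_pow (by omega))).2 ?_
  refine (Continuous.isOpen_support (by fun_prop)).measure_pos _ ⟨0, by simp⟩

lemma normSqOn_rectConv {p : ℕ} (hp : 2 ≤ p) :
    normSqOn (Set.Icc (-((p : ℝ) / 2)) ((p : ℝ) / 2)) (rectConv p) = sincI p / Real.pi := by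
  rw [← integral_rectConv_sq hp, normSqOn]
  simpa using setIntegral_mul_rectConv_sq p (fun _ => 1)

lemma spaceMean_rectConv (p : ℕ) :
    spaceMean (Set.Icc (-((p : ℝ) / 2)) ((p : ℝ) / 2)) (rectConv p) = 0 := by
  rw [spaceMean, setIntegral_mul_rectConv_sq p (fun x => x), integral_eq_zero_of_odd, mul_zero]
  intro x
  rw [rectConv_neg]
  ring

lemma spaceVariance_rectConv {p : ℕ} (hp : 2 ≤ p) :
    spaceVariance (Set.Icc (-((p : ℝ) / 2)) ((p : ℝ) / 2)) (rectConv p) =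
      (p : ℝ) ^ 2 * sincK p / (4 * sincI p) := by
  have := (sincI_pos (by omega : 1 ≤ p)).ne'
  rw [spaceVariance, spaceMean_rectConv, normSqOn_rectConv hp]
  simp_rw [sub_zero]
  rw [setIntegral_mul_rectConv_sq p (fun x => x ^ 2), integral_sq_mul_rectConv_sq hp]
  field_simp

lemma norm_fourierHat_rectConv_sq {p : ℕ} (hp : 1 ≤ p) (ω : ℝ) :
    ‖fourierHat (rectConv p) ω‖ ^ 2 = Real.sinc (ω / 2) ^ (2 * p) := by
  rw [fourierHat_rectConv hp, Complex.norm_real, Real.norm_eq_abs, sq_abs, ← pow_mul, mul_comm]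

lemma freqMean_rectConv {p : ℕ} (hp : 1 ≤ p) (K : Set ℝ) :
    freqMean K (rectConv p) = 0 := by
  rw [freqMean, integral_eq_zero_of_odd, mul_zero]
  intro ω
  rw [norm_fourierHat_rectConv_sq hp, norm_fourierHat_rectConv_sq hp, neg_div, Real.sinc_neg]
  ring

lemma sq_mul_sinc_pow {p : ℕ} (hp : 1 ≤ p) (t : ℝ) :
    t ^ 2 * Real.sinc t ^ (2 * p) = Real.sin t ^ 2 * Real.sinc t ^ (2 * p - 2) := by
  rw [sin_eq_mul_sinc, show 2 * p = 2 + (2 * p - 2) by omega, pow_add, mul_pow,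
    Nat.add_sub_cancel_left]
  ring

lemma integrable_sin_sq_mul_sinc_pow {n : ℕ} (hn : 2 ≤ n) :
    Integrable fun t => Real.sin t ^ 2 * Real.sinc t ^ n := by
  refine (integrable_sinc_pow_mul hn (f := fun t => Real.sin t ^ 2) (by fun_prop) (C := 1)
    fun t => ?_).congr (Filter.Eventually.of_forall fun t => mul_comm _ _)
  rw [abs_of_nonneg (sq_nonneg _)]
  exact Real.sin_sq_le_one t

lemma freqVariance_rectConv {p : ℕ} (hp : 2 ≤ p) :
    freqVariance (Set.Icc (-((p : ℝ) / 2)) ((p : ℝ) / 2)) (rectConv p) =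
      ENNReal.ofReal (4 * sincJ p / sincI p) := by
  have hI := sincI_pos (by omega : 1 ≤ p)
  have key : ∀ ω : ℝ, (ω - 0) ^ 2 * ‖fourierHat (rectConv p) ω‖ ^ 2 =
      (fun t => 4 * (Real.sin t ^ 2 * Real.sinc t ^ (2 * p - 2))) (1 / 2 * ω) := by
    intro ω
    simp only
    rw [norm_fourierHat_rectConv_sq (by omega), sub_zero, ← sq_mul_sinc_pow (by omega),
      show 1 / 2 * ω = ω / 2 by ring]
    ring
  have hint : Integrable fun ω : ℝ =>
      (fun t => 4 * (Real.sin t ^ 2 * Real.sinc t ^ (2 * p - 2))) (1 / 2 * ω) :=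
    ((integrable_sin_sq_mul_sinc_pow (by omega : 2 ≤ 2 * p - 2)).const_mul 4).comp_mul_left'
      (by norm_num)
  rw [freqVariance, freqMean_rectConv (by omega), normSqOn_rectConv hp]
  simp_rw [key]
  rw [← ofReal_integral_eq_lintegral_ofReal hint, Measure.integral_comp_mul_left
    (fun t => 4 * (Real.sin t ^ 2 * Real.sinc t ^ (2 * p - 2))), integral_const_mul, ← sincJ,
    ← ENNReal.ofReal_mul (by positivity)]
  · congr 1
    norm_num
    field_simp
  · refine Filter.Eventually.of_forall fun ω => ?_
    rw [← key]
    positivity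

lemma sincK_nonneg (p : ℕ) : 0 ≤ sincK p := by
  refine integral_nonneg fun t => ?_
  rw [show 2 * p - 2 = 2 * (p - 1) by omega, pow_mul]
  positivity

lemma rectUncertainty_eq {p : ℕ} (hp : 2 ≤ p) :
    rectUncertainty p = ENNReal.ofReal ((p : ℝ) ^ 2 * sincJ p * sincK p / sincI p ^ 2) := by
  have hI := sincI_pos (by omega : 1 ≤ p)
  have hK := sincK_nonneg p
  rw [rectUncertainty, uncertainty, spaceVariance_rectConv hp, freqVariance_rectConv hp,
    ← ENNReal.ofReal_mul (by positivity)]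
  congr 1
  field_simp

/-! ### Truncated-power formula for the B-splines -/

/-- The `k`-th divided truncated power summed against the `n`-th central difference. -/
noncomputable def truncSum (n k : ℕ) (x : ℝ) : ℝ :=
  ∑ j ∈ Finset.range (n + 1), (-1 : ℝ) ^ j * n.choose j *
    (max (x + n / 2 - j) 0 ^ k / k.factorial)

lemma hasDerivAt_max_pow {k : ℕ} (hk : 1 ≤ k) (x : ℝ) :
    HasDerivAt (fun x : ℝ => max x 0 ^ (k + 1) / (k + 1).factorial)
      (max x 0 ^ k / k.factorial) x := by
  have key : ∀ y : ℝ, y ≠ 0 → HasDerivAt (fun x : ℝ => max x 0 ^ (k + 1) / (k + 1).factorial)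
      (max y 0 ^ k / k.factorial) y := by
    intro y hy
    rcases lt_or_gt_of_ne hy with h | h
    · rw [max_eq_right h.le, zero_pow (by omega), zero_div]
      refine (hasDerivAt_const y (0 : ℝ)).congr_of_eventuallyEq ?_
      filter_upwards [Iio_mem_nhds h] with z hz
      rw [max_eq_right (le_of_lt hz), zero_pow (by omega), zero_div]
    · rw [max_eq_left h.le]
      have h1 := (hasDerivAt_pow (k + 1) y).div_const ((k + 1).factorial : ℝ)
      refine (h1.congr_of_eventuallyEq ?_).congr_deriv ?_
      · filter_upwards [Ioi_mem_nhds h] with z hz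
        rw [max_eq_left (le_of_lt hz)]
      · rw [Nat.factorial_succ, Nat.add_sub_cancel]
        push_cast
        have : (k.factorial : ℝ) ≠ 0 := by positivity
        field_simp
  rcases eq_or_ne x 0 with rfl | hx
  · exact hasDerivAt_of_hasDerivAt_of_ne key (Continuous.continuousAt (by fun_prop))
      (Continuous.continuousAt (by fun_prop))
  · exact key x hx

lemma continuous_truncSum (n k : ℕ) : Continuous (truncSum n k) := by
  unfold truncSum
  fun_prop

lemma hasDerivAt_truncSum (n : ℕ) {k : ℕ} (hk : 1 ≤ k) (x : ℝ) :
    HasDerivAt (truncSum n (k + 1)) (truncSum n k x) x := by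
  unfold truncSum
  refine HasDerivAt.fun_sum fun j _ => ?_
  refine HasDerivAt.const_mul _ ?_
  have h1 : HasDerivAt (fun x : ℝ => x + n / 2 - j) 1 x :=
    ((hasDerivAt_id x).add_const _).sub_const _
  exact ((hasDerivAt_max_pow hk (x + n / 2 - j)).comp x h1).congr_deriv (mul_one _)

lemma integral_truncSum (n : ℕ) {k : ℕ} (hk : 1 ≤ k) (a b : ℝ) :
    ∫ x in a..b, truncSum n k x = truncSum n (k + 1) b - truncSum n (k + 1) a :=
  intervalIntegral.integral_eq_sub_of_hasDerivAt (fun x _ => hasDerivAt_truncSum n hk x)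
    ((continuous_truncSum n k).intervalIntegrable _ _)

/-- Pascal's rule: the central difference of order n + 1 is the unit central difference of the one
of order n. -/
lemma truncSum_succ (n k : ℕ) (x : ℝ) :
    truncSum (n + 1) k x = truncSum n k (x + 1 / 2) - truncSum n k (x - 1 / 2) := by
  set φ : ℕ → ℝ := fun j => max (x + ((n + 1 : ℕ) : ℝ) / 2 - j) 0 ^ k / k.factorial with hφ
  have h1 : truncSum n k (x + 1 / 2) =
      ∑ j ∈ Finset.range (n + 1), (-1 : ℝ) ^ j * n.choose j * φ j := by
    refine Finset.sum_congr rfl fun j _ => ?_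
    simp only [hφ]
    push_cast
    congr 4
    ring
  have h2 : truncSum n k (x - 1 / 2) =
      ∑ j ∈ Finset.range (n + 1), (-1 : ℝ) ^ j * n.choose j * φ (j + 1) := by
    refine Finset.sum_congr rfl fun j _ => ?_
    simp only [hφ]
    push_cast
    congr 4
    ring
  have h3 : ∑ j ∈ Finset.range (n + 1), (-1 : ℝ) ^ j * n.choose j * φ j =
      ∑ j ∈ Finset.range (n + 1 + 1), (-1 : ℝ) ^ j * n.choose j * φ j := by
    rw [Finset.sum_range_succ _ (n + 1)]
    simp
  rw [h1, h2, h3, Finset.sum_range_succ', truncSum, Finset.sum_range_succ',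
    add_sub_right_comm (∑ j ∈ Finset.range (n + 1), _) (_ : ℝ) (∑ j ∈ Finset.range (n + 1), _),
    ← Finset.sum_sub_distrib]
  congr 1
  · refine Finset.sum_congr rfl fun j _ => ?_
    rw [Nat.choose_succ_succ]
    simp only [hφ]
    push_cast
    ring
  · simp [hφ]

lemma integral_rectConv_one (a b : ℝ) :
    ∫ x in a..b, rectConv 1 x = truncSum 1 1 b - truncSum 1 1 a := by
  have hF : ∀ x, truncSum 1 1 x = max (x + 1 / 2) 0 - max (x - 1 / 2) 0 := by
    intro x
    simp only [truncSum, Finset.sum_range_succ]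
    norm_num
    rw [show x + 1 / 2 - 1 = x - 1 / 2 by ring]
    ring
  refine integral_eq_of_hasDerivAt_off_countable _ _ (s := {-(1 / 2), 1 / 2})
    (Set.Countable.insert _ (Set.countable_singleton _)) (continuous_truncSum 1 1).continuousOn
    (fun x hx => ?_) (integrable_rectConv 1).intervalIntegrable
  have hx1 : x ≠ -(1 / 2) := fun h => hx.2 (by simp [h])
  have hx2 : x ≠ 1 / 2 := fun h => hx.2 (by simp [h])
  rw [rectConv_one]
  rcases lt_or_gt_of_ne hx1 with h1 | h1
  · rw [Set.indicator_of_notMem (fun h => by linarith [h.1])]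
    refine (hasDerivAt_const x (0 : ℝ)).congr_of_eventuallyEq ?_
    filter_upwards [Iio_mem_nhds h1] with z (hz : z < _)
    rw [hF, max_eq_right (by linarith), max_eq_right (by linarith), sub_zero]
  rcases lt_or_gt_of_ne hx2 with h2 | h2
  · rw [Set.indicator_of_mem (Set.mem_Icc.2 ⟨h1.le, h2.le⟩)]
    refine ((hasDerivAt_id x).add_const (1 / 2 : ℝ)).congr_of_eventuallyEq ?_
    filter_upwards [Iio_mem_nhds h2, Ioi_mem_nhds h1] with z (hz : z < _) (hz2 : _ < z)
    rw [hF, max_eq_left (by linarith), max_eq_right (by linarith), sub_zero, id]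
  · rw [Set.indicator_of_notMem (fun h => by linarith [h.2])]
    refine (hasDerivAt_const x (1 : ℝ)).congr_of_eventuallyEq ?_
    filter_upwards [Ioi_mem_nhds h2] with z (hz2 : _ < z)
    rw [hF, max_eq_left (by linarith), max_eq_left (by linarith)]
    ring

/-- Integrating over a unit window is a central difference of an antiderivative, which raises both
indices by one. The formula starts at n = 2 because `truncSum 1 0` vanishes identically, by the
convention 0⁰ = 1. -/
lemma rectConv_eq_truncSum {n : ℕ} (hn : 2 ≤ n) (x : ℝ) :
    rectConv n x = truncSum n (n - 1) x := by
  obtain ⟨m, rfl⟩ := Nat.exists_eq_add_of_le' hn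
  induction m generalizing x with
  | zero => rw [rectConv_succ_succ, integral_rectConv_one, ← truncSum_succ]
  | succ m ih =>
    rw [rectConv_succ_succ]
    have : rectConv (m + 1 + 1) = truncSum (m + 2) (m + 2 - 1) := funext fun s => ih s (by omega)
    rw [this, integral_truncSum _ (by omega), ← truncSum_succ]
    rfl

/-! ### Exact rational evaluation for small p -/

lemma sincI_eq_rectConv {p : ℕ} (hp : 1 ≤ p) : sincI p = Real.pi * rectConv (2 * p) 0 := by
  rw [← integral_sinc_pow_mul_cos (by omega), sincI]
  simp

/-- Write sin² t = (1 - cos 2t)/2 and apply Fourier inversion at 0 and 1. -/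
lemma sincJ_eq_rectConv {p : ℕ} (hp : 2 ≤ p) :
    sincJ p = Real.pi / 2 * (rectConv (2 * p - 2) 0 - rectConv (2 * p - 2) 1) := by
  have h0 := integral_sinc_pow_mul_cos (by omega : 2 ≤ 2 * p - 2) 0
  have h1 := integral_sinc_pow_mul_cos (by omega : 2 ≤ 2 * p - 2) 1
  have i0 := integrable_sinc_pow_mul (by omega : 2 ≤ 2 * p - 2)
    (f := fun t => Real.cos (2 * t * 0)) (by fun_prop) (C := 1) fun t => Real.abs_cos_le_one _
  have i1 := integrable_sinc_pow_mul (by omega : 2 ≤ 2 * p - 2)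
    (f := fun t => Real.cos (2 * t * 1)) (by fun_prop) (C := 1) fun t => Real.abs_cos_le_one _
  have : sincJ p = 1 / 2 * ((∫ t : ℝ, Real.sinc t ^ (2 * p - 2) * Real.cos (2 * t * 0)) -
      ∫ t : ℝ, Real.sinc t ^ (2 * p - 2) * Real.cos (2 * t * 1)) := by
    rw [← integral_sub i0 i1, ← integral_const_mul, sincJ]
    congr 1
    ext t
    rw [mul_zero, mul_one, Real.cos_zero, Real.sin_sq_eq_half_sub]
    ring
  rw [this, h0, h1]
  ring

/-- Split sinc'² sinc^{2p-2}: one factor sinc' is a sine transform of u on [-1/2, 1/2], and the rest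
is (sinc^{2p-1})' up to the factor 2p - 1. Parseval then leaves a second moment of a B-spline over a
single window. -/
lemma sincK_eq_integral_rectConv {p : ℕ} (hp : 2 ≤ p) :
    (2 * p - 1 : ℝ) * sincK p =
      4 * Real.pi * ∫ u in (-(1 / 2) : ℝ)..(1 / 2), u ^ 2 * rectConv (2 * p - 1) u := by
  have hcast : ((2 * p - 1 : ℕ) : ℝ) = 2 * p - 1 := by
    rw [Nat.cast_sub (by omega)]
    push_cast
    ring
  have hi : Integrable fun t => ((2 * p - 1 : ℕ) : ℝ) * Real.sinc t ^ (2 * p - 1 - 1) * dsinc t := by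
    refine ((integrable_sinc_pow_mul_dsinc_mul (by omega : 1 ≤ 2 * p - 1 - 1)
      (continuous_const (y := (1 : ℝ))) (C := 1) (by simp)).const_mul
        ((2 * p - 1 : ℕ) : ℝ)).congr (Filter.Eventually.of_forall fun t => ?_)
    simp only
    ring
  set f : ℝ → ℝ := Set.indicator (Set.Icc (-(1 / 2) : ℝ) (1 / 2)) fun u => u with hf
  have hfi : Integrable f := (integrable_indicator_iff measurableSet_Icc).2
    continuous_id.integrableOn_Icc
  have hfint : ∀ w : ℝ → ℝ, ∫ u, f u * w u = ∫ u in (-(1 / 2) : ℝ)..(1 / 2), u * w u := by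
    intro w
    rw [intervalIntegral.integral_of_le (by norm_num), ← integral_Icc_eq_integral_Ioc,
      ← integral_indicator measurableSet_Icc]
    congr 1
    ext u
    rw [hf]
    by_cases hu : u ∈ Set.Icc (-(1 / 2) : ℝ) (1 / 2)
    · simp only [Set.indicator_of_mem hu]
    · simp only [Set.indicator_of_notMem hu, zero_mul]
  have h := integral_mul_integral_swap hfi hi
    (k := fun x t => Real.sin (2 * t * x)) (by fun_prop) fun x t => Real.abs_sin_le_one _
  simp_rw [integral_deriv_sinc_pow_mul_sin (by omega : 2 ≤ 2 * p - 1), hfint] at h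
  have h1 : ∀ t, ∫ u in (-(1 / 2) : ℝ)..(1 / 2), u * Real.sin (2 * t * u) = -(1 / 2) * dsinc t := by
    intro t
    rw [dsinc_eq_integral]
    ring
  simp_rw [h1] at h
  have h2 : ∫ t, ((2 * p - 1 : ℕ) : ℝ) * Real.sinc t ^ (2 * p - 1 - 1) * dsinc t *
      (-(1 / 2) * dsinc t) = -(1 / 2) * ((2 * p - 1 : ℝ) * sincK p) := by
    rw [sincK, ← integral_const_mul, ← integral_const_mul]
    congr 1
    ext t
    rw [hcast, Nat.sub_sub]
    ring
  have h3 : ∫ u in (-(1 / 2) : ℝ)..(1 / 2), u * (-2 * Real.pi * (u * rectConv (2 * p - 1) u)) =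
      -2 * Real.pi * ∫ u in (-(1 / 2) : ℝ)..(1 / 2), u ^ 2 * rectConv (2 * p - 1) u := by
    rw [← intervalIntegral.integral_const_mul]
    congr 1
    ext u
    ring
  rw [h2, h3] at h
  linarith

lemma integral_sq_mul_truncSum (n : ℕ) {k : ℕ} (hk : 1 ≤ k) :
    ∫ u in (-(1 / 2) : ℝ)..(1 / 2), u ^ 2 * truncSum n k u =
      1 / 4 * (truncSum n (k + 1) (1 / 2) - truncSum n (k + 1) (-(1 / 2))) -
      (truncSum n (k + 2) (1 / 2) + truncSum n (k + 2) (-(1 / 2))) +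
      2 * (truncSum n (k + 3) (1 / 2) - truncSum n (k + 3) (-(1 / 2))) := by
  have hd : ∀ u : ℝ, HasDerivAt (fun u => u ^ 2 * truncSum n (k + 1) u -
      2 * u * truncSum n (k + 2) u + 2 * truncSum n (k + 3) u) (u ^ 2 * truncSum n k u) u := by
    intro u
    have h1 := ((hasDerivAt_pow 2 u).mul (hasDerivAt_truncSum n hk u))
    have h2 := (((hasDerivAt_id u).const_mul 2).mul
      (hasDerivAt_truncSum n (by omega : 1 ≤ k + 1) u))
    have h3 := (hasDerivAt_truncSum n (by omega : 1 ≤ k + 2) u).const_mul 2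
    refine ((h1.sub h2).add h3).congr_deriv ?_
    simp only [id]
    push_cast
    ring
  rw [intervalIntegral.integral_eq_sub_of_hasDerivAt (fun u _ => hd u)
    (((continuous_pow 2).mul (continuous_truncSum n k)).intervalIntegrable _ _)]
  ring

/-- The rational value of `truncSum n k x` when `x + n / 2 = m`. -/
def truncSumRat (n k m : ℕ) : ℚ :=
  ((∑ j ∈ Finset.range (n + 1), (-1 : ℤ) ^ j *
    ((n.descFactorial j / j.factorial * (m - j) ^ k : ℕ) : ℤ) : ℤ) : ℚ) / (k.factorial : ℚ)

/-- Subtraction in ℕ truncates at 0 exactly as the maximum does. The binomials appear as quotients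
of a descending factorial, a form suited to kernel evaluation. -/
lemma truncSum_eq_truncSumRat {n k m : ℕ} {x : ℝ} (h : x + n / 2 = m) :
    truncSum n k x = truncSumRat n k m := by
  have hmax : ∀ j : ℕ, max ((m : ℝ) - j) 0 = ((m - j : ℕ) : ℝ) := by
    intro j
    rcases le_total j m with hj | hj
    · rw [Nat.cast_sub hj, max_eq_left (sub_nonneg.2 (by exact_mod_cast hj))]
    · rw [Nat.sub_eq_zero_of_le hj, max_eq_right (sub_nonpos.2 (by exact_mod_cast hj))]
      simp
  simp only [truncSum, truncSumRat, h, hmax, ← Nat.choose_eq_descFactorial_div_factorial]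
  push_cast
  rw [Finset.sum_div]
  refine Finset.sum_congr rfl fun j _ => ?_
  ring

/-- The rational value of the uncertainty of `rectConv p`. -/
def rectUncertaintyRat (p : ℕ) : ℚ :=
  (p : ℚ) ^ 2 * (2 * (truncSumRat (2 * p - 2) (2 * p - 3) (p - 1) -
      truncSumRat (2 * p - 2) (2 * p - 3) p)) *
    ((1 / 4 * (truncSumRat (2 * p - 1) (2 * p - 1) p - truncSumRat (2 * p - 1) (2 * p - 1) (p - 1)) -
      (truncSumRat (2 * p - 1) (2 * p) p + truncSumRat (2 * p - 1) (2 * p) (p - 1)) +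
      2 * (truncSumRat (2 * p - 1) (2 * p + 1) p - truncSumRat (2 * p - 1) (2 * p + 1) (p - 1)))
      / (2 * p - 1)) / truncSumRat (2 * p) (2 * p - 1) p ^ 2

lemma uncertainty_eq_rectUncertaintyRat {p : ℕ} (hp : 2 ≤ p) :
    (p : ℝ) ^ 2 * sincJ p * sincK p / sincI p ^ 2 = rectUncertaintyRat p := by
  obtain ⟨q, rfl⟩ := Nat.exists_eq_add_of_le' hp
  have hK := sincK_eq_integral_rectConv hp
  have hpos : (0 : ℝ) < 2 * (q + 2 : ℕ) - 1 := by push_cast; linarith [q.cast_nonneg (α := ℝ)]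
  rw [mul_comm, ← eq_div_iff hpos.ne'] at hK
  have hfun : ∀ u, u ^ 2 * rectConv (2 * (q + 2) - 1) u =
      u ^ 2 * truncSum (2 * q + 3) (2 * q + 2) u := fun u => by
    rw [rectConv_eq_truncSum (by omega)]
    rfl
  have v0 : rectConv (2 * (q + 2)) 0 = truncSumRat (2 * q + 4) (2 * q + 3) (q + 2) := by
    rw [rectConv_eq_truncSum (by omega)]
    exact truncSum_eq_truncSumRat (by push_cast; ring)
  have v1 : rectConv (2 * (q + 2) - 2) 0 = truncSumRat (2 * q + 2) (2 * q + 1) (q + 1) := by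
    rw [rectConv_eq_truncSum (by omega)]
    exact truncSum_eq_truncSumRat (n := 2 * q + 2) (by push_cast; ring)
  have v2 : rectConv (2 * (q + 2) - 2) 1 = truncSumRat (2 * q + 2) (2 * q + 1) (q + 2) := by
    rw [rectConv_eq_truncSum (by omega)]
    exact truncSum_eq_truncSumRat (n := 2 * q + 2) (by push_cast; ring)
  have e1 : ∀ k, truncSum (2 * q + 3) k (1 / 2) = truncSumRat (2 * q + 3) k (q + 2) := fun k =>
    truncSum_eq_truncSumRat (by push_cast; ring)
  have e2 : ∀ k, truncSum (2 * q + 3) k (-(1 / 2)) = truncSumRat (2 * q + 3) k (q + 1) := fun k =>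
    truncSum_eq_truncSumRat (by push_cast; ring)
  have hR : rectUncertaintyRat (q + 2) =
      ((q + 2 : ℕ) : ℚ) ^ 2 * (2 * (truncSumRat (2 * q + 2) (2 * q + 1) (q + 1) -
        truncSumRat (2 * q + 2) (2 * q + 1) (q + 2))) *
      ((1 / 4 * (truncSumRat (2 * q + 3) (2 * q + 3) (q + 2) -
          truncSumRat (2 * q + 3) (2 * q + 3) (q + 1)) -
        (truncSumRat (2 * q + 3) (2 * q + 4) (q + 2) +
          truncSumRat (2 * q + 3) (2 * q + 4) (q + 1)) +
        2 * (truncSumRat (2 * q + 3) (2 * q + 5) (q + 2) -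
          truncSumRat (2 * q + 3) (2 * q + 5) (q + 1)))
        / (2 * ((q + 2 : ℕ) : ℚ) - 1)) / truncSumRat (2 * q + 4) (2 * q + 3) (q + 2) ^ 2 := rfl
  rw [hK, sincI_eq_rectConv (by omega), sincJ_eq_rectConv hp, v0, v1, v2, hR]
  simp_rw [hfun]
  rw [integral_sq_mul_truncSum _ (by omega)]
  simp only [e1, e2]
  push_cast at hpos ⊢
  generalize (truncSumRat (2 * q + 4) (2 * q + 3) (q + 2) : ℝ) = a
  have h := Real.pi_ne_zero
  -- Positivity of the denominator is not needed: if it vanished, both sides would be 0 by the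
  -- convention x/0 = 0.
  rcases eq_or_ne a 0 with rfl | ha
  · simp
  field_simp
  ring

set_option maxRecDepth 100000 in
lemma rectUncertaintyRat_succ_lt : ∀ p ∈ Finset.Ico 2 40,
    rectUncertaintyRat (p + 1) < rectUncertaintyRat p := by
  decide +kernel

/-! ### Comparing powers of sinc through the Euler product -/

lemma tendsto_prod_sinc (s : ℝ) :
    Filter.Tendsto (fun n : ℕ => ∏ j ∈ Finset.range n, (1 - s ^ 2 / (Real.pi * (j + 1)) ^ 2))
      Filter.atTop (nhds (Real.sinc s)) := by
  rcases eq_or_ne s 0 with rfl | hs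
  · simp
  have h := (Real.tendsto_euler_sin_prod (s / Real.pi)).const_mul (1 / s)
  have hpi := Real.pi_ne_zero
  rw [mul_div_cancel₀ _ hpi, one_div_mul_eq_div, ← Real.sinc_of_ne_zero hs] at h
  refine h.congr fun n => ?_
  rw [← mul_assoc, one_div_mul_cancel hs, one_mul]
  refine Finset.prod_congr rfl fun j _ => ?_
  rw [div_pow, mul_pow, div_div]

lemma sinc_pow_le_sinc_pow {s t : ℝ} {m n : ℕ}
    (h0 : ∀ j : ℕ, 0 ≤ 1 - s ^ 2 / (Real.pi * (j + 1)) ^ 2)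
    (h : ∀ j : ℕ, (1 - s ^ 2 / (Real.pi * (j + 1)) ^ 2) ^ m ≤
      (1 - t ^ 2 / (Real.pi * (j + 1)) ^ 2) ^ n) :
    Real.sinc s ^ m ≤ Real.sinc t ^ n := by
  refine le_of_tendsto_of_tendsto' ((tendsto_prod_sinc s).pow m) ((tendsto_prod_sinc t).pow n)
    fun N => ?_
  rw [← Finset.prod_pow, ← Finset.prod_pow]
  exact Finset.prod_le_prod (fun j _ => pow_nonneg (h0 j) m) fun j _ => h j

lemma sq_div_pi_mul_sq_le {s c : ℝ} (hs : s ^ 2 ≤ c * Real.pi ^ 2) (j : ℕ) :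
    s ^ 2 / (Real.pi * (j + 1)) ^ 2 ≤ c := by
  have hpi := Real.pi_pos
  have hc : 0 ≤ c := nonneg_of_mul_nonneg_left ((sq_nonneg s).trans hs) (by positivity)
  rw [div_le_iff₀ (by positivity)]
  have : (1 : ℝ) ≤ (j + 1 : ℝ) ^ 2 := by
    have : (0 : ℝ) ≤ j := j.cast_nonneg
    nlinarith
  calc _ ≤ c * Real.pi ^ 2 * 1 := by rwa [mul_one]
    _ ≤ c * Real.pi ^ 2 * (j + 1 : ℝ) ^ 2 := by gcongr
    _ = _ := by ring

/-- Bernoulli's inequality with exponent m/n ≤ 1, raised to the power n. -/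
lemma one_sub_pow_le_one_sub_mul_pow {y x : ℝ} {m n : ℕ} (hn : 0 < n) (hmn : m ≤ n)
    (hx : n * x = m * y) (hy1 : y ≤ 1) : (1 - y) ^ m ≤ (1 - x) ^ n := by
  have hn' : (0 : ℝ) < n := by exact_mod_cast hn
  have h := rpow_one_add_le_one_add_mul_self (s := -y) (by linarith) (p := (m : ℝ) / n)
    (by positivity) ((div_le_one hn').2 (by exact_mod_cast hmn))
  have hx' : 1 + (m : ℝ) / n * -y = 1 - x := by
    field_simp
    linarith
  rw [hx', ← sub_eq_add_neg] at h
  have h0 : 0 ≤ 1 - y := by linarith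
  calc (1 - y) ^ m = ((1 - y) ^ ((m : ℝ) / n)) ^ n := by
        rw [← Real.rpow_natCast (_ ^ _) n, ← Real.rpow_mul h0, div_mul_cancel₀ _ hn'.ne',
          Real.rpow_natCast]
    _ ≤ _ := by gcongr

/-- `-log (sinc s) / s²` is increasing on `(0, π]`. -/
lemma sinc_pow_le_of_mul_sq_eq {s t : ℝ} {m n : ℕ} (hn : 0 < n) (hmn : m ≤ n)
    (hs : s ^ 2 ≤ Real.pi ^ 2) (hst : n * t ^ 2 = m * s ^ 2) :
    Real.sinc s ^ m ≤ Real.sinc t ^ n := by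
  have hb : ∀ j : ℕ, s ^ 2 / (Real.pi * (j + 1)) ^ 2 ≤ 1 :=
    sq_div_pi_mul_sq_le (by rwa [one_mul])
  refine sinc_pow_le_sinc_pow (fun j => sub_nonneg.2 (hb j)) fun j => ?_
  refine one_sub_pow_le_one_sub_mul_pow hn hmn ?_ (hb j)
  rw [← mul_div_assoc, hst, mul_div_assoc]

/-- A partial converse of Bernoulli. With 1 in place of 7/10 the inequality would go the other way;
7/10 makes it true for y ≤ 3/8, and still exceeds the 3/5 needed for the final first-order
comparison. -/
lemma one_sub_mul_pow_le_one_sub_pow {y : ℝ} (p : ℕ) (hy0 : 0 ≤ y) (hy : y ≤ 3 / 8) :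
    (1 - (1 - 7 / (10 * (p + 1))) * y) ^ (p + 1) ≤ (1 - y) ^ p := by
  have h1y : 0 < 1 - y := by linarith
  have hp : (0 : ℝ) < p + 1 := by positivity
  set z := 7 / 10 * y / (1 - y) with hz
  have hz0 : 0 ≤ z := by positivity
  have hz1 : z ≤ 3 / 7 := by
    rw [hz, div_le_iff₀ h1y]; linarith
  have e1 : 1 - (1 - 7 / (10 * (p + 1))) * y = (1 - y) * (1 + z / (p + 1)) := by
    rw [hz]; field_simp; ring
  have e2 : (1 + z / (p + 1)) ^ (p + 1) ≤ Real.exp z := by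
    calc _ ≤ Real.exp (z / (p + 1)) ^ (p + 1) := by
          gcongr
          linarith [Real.add_one_le_exp (z / (p + 1))]
      _ = Real.exp z := by
          rw [← Real.exp_nat_mul]
          congr 1
          push_cast
          field_simp
  -- From exp z ≤ 1 + z + z² and z² ≤ (3/7) z; note 1 + 3/7 = 10/7. This is where y ≤ 3/8 enters.
  have e3 : Real.exp z ≤ 1 + z / (7 / 10) := by
    have := (abs_le.1 (Real.abs_exp_sub_one_sub_id_le (x := z)
      (abs_le.2 ⟨by linarith, by linarith⟩))).2
    nlinarith
  have e4 : (1 - y) * (1 + z / (7 / 10)) = 1 := by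
    rw [hz]; field_simp; ring
  rw [e1, mul_pow, pow_succ, mul_assoc]
  refine mul_le_of_le_one_right (by positivity) ?_
  calc (1 - y) * (1 + z / (p + 1)) ^ (p + 1) ≤ (1 - y) * (1 + z / (7 / 10)) := by
        gcongr; exact e2.trans e3
    _ = 1 := e4

lemma sinc_pow_succ_le_sinc_pow {s t : ℝ} (p : ℕ) (hs : s ^ 2 ≤ 3 / 8 * Real.pi ^ 2)
    (ht : t ^ 2 = (1 - 7 / (10 * (p + 1))) * s ^ 2) :
    Real.sinc t ^ (p + 1) ≤ Real.sinc s ^ p := by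
  have hp : (0 : ℝ) < p + 1 := by positivity
  have hts : t ^ 2 ≤ s ^ 2 := by
    rw [ht]
    refine mul_le_of_le_one_left (sq_nonneg s) ?_
    have : 0 ≤ 7 / (10 * ((p : ℝ) + 1)) := by positivity
    linarith
  refine sinc_pow_le_sinc_pow (fun j => ?_) fun j => ?_
  · linarith [sq_div_pi_mul_sq_le (hts.trans hs) j]
  · rw [ht, mul_div_assoc]
    exact one_sub_mul_pow_le_one_sub_pow p (by positivity) (sq_div_pi_mul_sq_le hs j)

lemma sinc_pos_of_sq_lt {s : ℝ} (hs : s ^ 2 < Real.pi ^ 2) : 0 < Real.sinc s := by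
  rcases eq_or_ne s 0 with rfl | h0
  · simp
  have h := abs_lt_of_sq_lt_sq hs Real.pi_pos.le
  have : Real.sinc s = Real.sinc |s| := by
    rcases abs_choice s with h | h <;> rw [h]
    rw [Real.sinc_neg]
  rw [this, Real.sinc_of_ne_zero (abs_ne_zero.2 h0)]
  have h1 := abs_pos.2 h0
  exact div_pos (Real.sin_pos_of_pos_of_lt_pi h1 h) h1

lemma pi_sq_le_pi_mul_sq (n : ℕ) : Real.pi ^ 2 ≤ (Real.pi * (n + 1)) ^ 2 := by
  have : (0 : ℝ) ≤ n := n.cast_nonneg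
  have := Real.pi_pos
  gcongr
  nlinarith

/-! ### The logarithmic derivative of sinc -/

/-- `-sinc' s / (s sinc s)`, the derivative of `-log sinc` divided by the variable. -/
noncomputable def sincSlope (s : ℝ) : ℝ := -dsinc s / (s * Real.sinc s)

/-- The Mittag-Leffler expansion of π cot(πx) at x = s/π, rescaled. -/
lemma hasSum_sincSlope {s : ℝ} (h0 : s ≠ 0) (hs : s ^ 2 < Real.pi ^ 2) :
    HasSum (fun n : ℕ => 2 / ((Real.pi * (n + 1)) ^ 2 - s ^ 2)) (sincSlope s) := by
  have hpi := Real.pi_pos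
  have habs := abs_lt_of_sq_lt_sq hs Real.pi_pos.le
  have hA : ∀ n : ℕ, 0 < (Real.pi * (n + 1)) ^ 2 - s ^ 2 := fun n => by
    linarith [pi_sq_le_pi_mul_sq n]
  set x : ℝ := s / Real.pi with hx
  have hx0 : x ≠ 0 := div_ne_zero h0 hpi.ne'
  have hxs : s = Real.pi * x := by rw [hx]; field_simp
  have hmem : (x : ℂ) ∈ Complex.integerComplement := by
    rintro ⟨k, hk⟩
    have hk' : (k : ℝ) = x := by exact_mod_cast hk
    have h1 : |(k : ℝ)| < 1 := by
      rw [hk', hx, abs_div, abs_of_pos hpi, div_lt_one hpi]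
      exact habs
    have h2 : |k| < 1 := by exact_mod_cast h1
    rw [Int.abs_lt_one_iff] at h2
    rw [h2, Int.cast_zero] at hk'
    exact hx0 hk'.symm
  have hsum := (summable_cotTerm hmem).hasSum
  have htsum : ∑' n : ℕ, cotTerm x n = Real.pi * Complex.cot (Real.pi * x) - 1 / x :=
    (cot_series_rep' hmem).symm
  rw [htsum] at hsum
  have hre := (Complex.reCLM.hasSum hsum).mul_left (-(1 / (Real.pi ^ 2 * x)))
  have hval : sincSlope s =
      -(1 / (Real.pi ^ 2 * x)) *
        Complex.reCLM (Real.pi * Complex.cot (Real.pi * x) - 1 / x) := by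
    have hcot : Real.pi * Complex.cot (Real.pi * x) - 1 / x =
        ((Real.pi * Real.cot (Real.pi * x) - 1 / x : ℝ) : ℂ) := by
      push_cast
      rfl
    rw [hcot, Complex.reCLM_apply, Complex.ofReal_re, sincSlope, dsinc, ← hxs,
      Real.cot_eq_cos_div_sin, Real.sinc_of_ne_zero h0]
    have hsin : Real.sin s ≠ 0 := by
      have := (sinc_pos_of_sq_lt hs).ne'
      rw [Real.sinc_of_ne_zero h0] at this
      exact fun h => this (by rw [h, zero_div])
    rw [hx]
    field_simp
  rw [hval]
  refine (congrArg (fun f => HasSum f _) (funext fun n => ?_)).mpr hre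
  have hterm : cotTerm x n = ((2 * x * (1 / ((x + (n + 1)) * (x - (n + 1)))) : ℝ) : ℂ) := by
    rw [cotTerm_identity hmem]
    push_cast
    rfl
  simp only [hterm, Complex.reCLM_apply, Complex.ofReal_re]
  have h3 : (Real.pi * (n + 1)) ^ 2 - s ^ 2 =
      -(Real.pi ^ 2 * ((x + (n + 1)) * (x - (n + 1)))) := by
    rw [hxs]; ring
  have h4 : (x + (n + 1)) * (x - (n + 1)) ≠ 0 := by
    intro h
    have := hA n
    rw [h3, h] at this
    simp at this
  rw [h3]
  field_simp

lemma hasSum_sincSlope_sub {s t : ℝ} (hs0 : s ≠ 0) (ht0 : t ≠ 0) (hs : s ^ 2 < Real.pi ^ 2)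
    (ht : t ^ 2 < Real.pi ^ 2) :
    HasSum (fun n : ℕ => 2 * (s ^ 2 - t ^ 2) /
      (((Real.pi * (n + 1)) ^ 2 - s ^ 2) * ((Real.pi * (n + 1)) ^ 2 - t ^ 2)))
      (sincSlope s - sincSlope t) := by
  refine (congrArg (fun f => HasSum f _) (funext fun n => ?_)).mpr
    ((hasSum_sincSlope hs0 hs).sub (hasSum_sincSlope ht0 ht))
  have hA := pi_sq_le_pi_mul_sq n
  have h1 : (Real.pi * (n + 1)) ^ 2 - s ^ 2 ≠ 0 := by linarith
  have h2 : (Real.pi * (n + 1)) ^ 2 - t ^ 2 ≠ 0 := by linarith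
  rw [div_sub_div _ _ h1 h2]
  congr 1
  ring

/-- All terms of the series are nonnegative; only the first is kept. -/
lemma sincSlope_sub_ge {s t : ℝ} (hs0 : s ≠ 0) (ht0 : t ≠ 0) (hs : s ^ 2 < Real.pi ^ 2)
    (hts : t ^ 2 ≤ s ^ 2) :
    2 * (s ^ 2 - t ^ 2) / Real.pi ^ 4 ≤ sincSlope s - sincSlope t := by
  have hpi := Real.pi_pos
  have h := hasSum_sincSlope_sub hs0 ht0 hs (hts.trans_lt hs)
  have h1 := le_hasSum h 0 fun n _ => by
    have := pi_sq_le_pi_mul_sq n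
    have h1 : 0 < (Real.pi * (n + 1)) ^ 2 - s ^ 2 := by linarith
    have h2 : 0 < (Real.pi * (n + 1)) ^ 2 - t ^ 2 := by linarith
    have h3 : 0 ≤ s ^ 2 - t ^ 2 := by linarith
    positivity
  refine le_trans ?_ h1
  simp only [Nat.cast_zero, zero_add, mul_one]
  have h2 : 0 < Real.pi ^ 2 - s ^ 2 := by linarith
  have h3 : 0 < Real.pi ^ 2 - t ^ 2 := by linarith
  have h4 : 0 ≤ s ^ 2 - t ^ 2 := by linarith
  gcongr
  calc _ ≤ Real.pi ^ 2 * Real.pi ^ 2 := by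
        gcongr <;> nlinarith [sq_nonneg s, sq_nonneg t]
    _ = _ := by ring

/-- In each term of the series the dilation multiplies the numerator by c² and enlarges the
denominators, so the difference shrinks by at least c². -/
lemma sincSlope_mul_sub_le {s t c : ℝ} (hs0 : s ≠ 0) (ht0 : t ≠ 0) (hs : s ^ 2 < Real.pi ^ 2)
    (ht : t ^ 2 < Real.pi ^ 2) (hc0 : 0 < c) (hc1 : c ≤ 1) :
    (sincSlope (c * s) - sincSlope (c * t)) ^ 2 ≤
      c ^ 4 * (sincSlope s - sincSlope t) ^ 2 := by
  wlog hts : t ^ 2 ≤ s ^ 2 generalizing s t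
  · have := this ht0 hs0 ht hs (le_of_not_ge hts)
    linarith
  have hc2 : c ^ 2 ≤ 1 := pow_le_one₀ hc0.le hc1
  have hcs : (c * s) ^ 2 ≤ s ^ 2 := by
    rw [mul_pow]; exact mul_le_of_le_one_left (sq_nonneg s) hc2
  have hct : (c * t) ^ 2 ≤ t ^ 2 := by
    rw [mul_pow]; exact mul_le_of_le_one_left (sq_nonneg t) hc2
  have h1 := hasSum_sincSlope_sub hs0 ht0 hs ht
  have h2 := hasSum_sincSlope_sub (mul_ne_zero hc0.ne' hs0) (mul_ne_zero hc0.ne' ht0)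
    (hcs.trans_lt hs) (hct.trans_lt ht)
  have h3 : 0 ≤ sincSlope (c * s) - sincSlope (c * t) := by
    refine h2.nonneg fun n => ?_
    have := pi_sq_le_pi_mul_sq n
    have h1 : 0 < (Real.pi * (n + 1)) ^ 2 - (c * s) ^ 2 := by linarith
    have h2 : 0 < (Real.pi * (n + 1)) ^ 2 - (c * t) ^ 2 := by linarith
    have h3 : 0 ≤ (c * s) ^ 2 - (c * t) ^ 2 := by
      rw [mul_pow, mul_pow, ← mul_sub]
      exact mul_nonneg (sq_nonneg c) (by linarith)
    positivity
  have h4 : sincSlope (c * s) - sincSlope (c * t) ≤ c ^ 2 * (sincSlope s - sincSlope t) := by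
    refine hasSum_le (fun n => ?_) h2 (h1.mul_left (c ^ 2))
    have := pi_sq_le_pi_mul_sq n
    have h5 : 0 < (Real.pi * (n + 1)) ^ 2 - s ^ 2 := by linarith
    have h6 : 0 < (Real.pi * (n + 1)) ^ 2 - t ^ 2 := by linarith
    have h7 : 0 ≤ s ^ 2 - t ^ 2 := by linarith
    have h8 : 0 ≤ (Real.pi * (n + 1)) ^ 2 - (c * s) ^ 2 := by linarith
    calc _ = c ^ 2 * (2 * (s ^ 2 - t ^ 2) / (((Real.pi * (n + 1)) ^ 2 - (c * s) ^ 2) *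
          ((Real.pi * (n + 1)) ^ 2 - (c * t) ^ 2))) := by ring
      _ ≤ _ := by gcongr
  calc _ ≤ (c ^ 2 * (sincSlope s - sincSlope t)) ^ 2 := by gcongr
    _ = _ := by ring

/-! ### The Gram determinant -/

/-- The integrand of the Gram determinant of `sin * sinc ^ m` and `sinc' * sinc ^ m`. -/
noncomputable def gramKernel (m : ℕ) (s t : ℝ) : ℝ :=
  (Real.sin t * dsinc s - Real.sin s * dsinc t) ^ 2 * (Real.sinc s * Real.sinc t) ^ (2 * m)

lemma gramKernel_eq {m : ℕ} {s t : ℝ} (hs0 : s ≠ 0) (ht0 : t ≠ 0) (hs : s ^ 2 < Real.pi ^ 2)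
    (ht : t ^ 2 < Real.pi ^ 2) :
    gramKernel m s t = s ^ 2 * t ^ 2 * (sincSlope s - sincSlope t) ^ 2 *
      (Real.sinc s * Real.sinc t) ^ (2 * (m + 1)) := by
  have h1 := (sinc_pos_of_sq_lt hs).ne'
  have h2 := (sinc_pos_of_sq_lt ht).ne'
  have h3 : dsinc s = -(s * Real.sinc s * sincSlope s) := by
    rw [sincSlope]; field_simp
  have h4 : dsinc t = -(t * Real.sinc t * sincSlope t) := by
    rw [sincSlope]; field_simp
  rw [gramKernel, h3, h4, sin_eq_mul_sinc s, sin_eq_mul_sinc t]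
  ring

lemma gramKernel_zero_left (m : ℕ) (t : ℝ) : gramKernel m 0 t = 0 := by
  simp [gramKernel, dsinc]

lemma gramKernel_zero_right (m : ℕ) (s : ℝ) : gramKernel m s 0 = 0 := by
  simp [gramKernel, dsinc]

lemma gramKernel_nonneg (m : ℕ) (s t : ℝ) : 0 ≤ gramKernel m s t := by
  rw [gramKernel, pow_mul]
  positivity

/-- The kernels of consecutive order are related by dilation. -/
lemma gramKernel_succ_mul_le {m : ℕ} {s t c : ℝ} (hc0 : 0 < c)
    (hc : c ^ 2 = 1 - 7 / (10 * ((m + 1 : ℕ) + 1))) (hs : s ^ 2 ≤ 3 / 8 * Real.pi ^ 2)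
    (ht : t ^ 2 ≤ 3 / 8 * Real.pi ^ 2) :
    gramKernel (m + 1) (c * s) (c * t) ≤ c ^ 8 * gramKernel m s t := by
  rcases eq_or_ne s 0 with rfl | hs0
  · simp [gramKernel_zero_left]
  rcases eq_or_ne t 0 with rfl | ht0
  · simp [gramKernel_zero_right]
  have hpi : 0 < Real.pi ^ 2 := by positivity
  have hs' : s ^ 2 < Real.pi ^ 2 := by linarith
  have ht' : t ^ 2 < Real.pi ^ 2 := by linarith
  have hc2 : c ^ 2 ≤ 1 := by
    rw [hc]
    have : 0 ≤ 7 / (10 * (((m + 1 : ℕ) : ℝ) + 1)) := by positivity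
    linarith
  have hc1 : c ≤ 1 := by nlinarith
  have hcs : (c * s) ^ 2 < Real.pi ^ 2 := by
    rw [mul_pow]; exact (mul_le_of_le_one_left (sq_nonneg s) hc2).trans_lt hs'
  have hct : (c * t) ^ 2 < Real.pi ^ 2 := by
    rw [mul_pow]; exact (mul_le_of_le_one_left (sq_nonneg t) hc2).trans_lt ht'
  have p1 := sinc_pos_of_sq_lt hs'
  have p2 := sinc_pos_of_sq_lt ht'
  have p3 := sinc_pos_of_sq_lt hcs
  have p4 := sinc_pos_of_sq_lt hct
  have q1 : Real.sinc (c * s) ^ (m + 1 + 1) ≤ Real.sinc s ^ (m + 1) :=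
    sinc_pow_succ_le_sinc_pow (m + 1) hs (by rw [mul_pow, hc])
  have q2 : Real.sinc (c * t) ^ (m + 1 + 1) ≤ Real.sinc t ^ (m + 1) :=
    sinc_pow_succ_le_sinc_pow (m + 1) ht (by rw [mul_pow, hc])
  rw [gramKernel_eq (mul_ne_zero hc0.ne' hs0) (mul_ne_zero hc0.ne' ht0) hcs hct,
    gramKernel_eq hs0 ht0 hs' ht']
  have r1 := sincSlope_mul_sub_le hs0 ht0 hs' ht' hc0 hc1
  have r2 : (Real.sinc (c * s) * Real.sinc (c * t)) ^ (2 * (m + 1 + 1)) ≤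
      (Real.sinc s * Real.sinc t) ^ (2 * (m + 1)) := by
    rw [mul_comm 2, mul_comm 2, pow_mul, pow_mul, mul_pow, mul_pow (Real.sinc s)]
    gcongr
  -- The factor c⁸ is c⁴ from s²t² times c⁴ from the squared slope difference.
  calc _ ≤ (c * s) ^ 2 * (c * t) ^ 2 * (c ^ 4 * (sincSlope s - sincSlope t) ^ 2) *
        (Real.sinc s * Real.sinc t) ^ (2 * (m + 1)) := by gcongr
    _ = _ := by ring

lemma le_gramKernel {m : ℕ} {s t : ℝ} (hs : s ^ 2 < Real.pi ^ 2) (hts : t ^ 2 ≤ s ^ 2) :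
    s ^ 2 * t ^ 2 * (2 * (s ^ 2 - t ^ 2) / Real.pi ^ 4) ^ 2 *
      (Real.sinc s * Real.sinc t) ^ (2 * (m + 1)) ≤ gramKernel m s t := by
  rcases eq_or_ne s 0 with rfl | hs0
  · simp [gramKernel_zero_left]
  rcases eq_or_ne t 0 with rfl | ht0
  · simp [gramKernel_zero_right]
  rw [gramKernel_eq hs0 ht0 hs (hts.trans_lt hs), pow_mul _ 2]
  have h0 : 0 ≤ 2 * (s ^ 2 - t ^ 2) / Real.pi ^ 4 := by
    have : 0 ≤ s ^ 2 - t ^ 2 := by linarith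
    positivity
  gcongr
  exact sincSlope_sub_ge hs0 ht0 hs hts

/-- Twice the Gram determinant of `sin * sinc ^ m` and `sinc' * sinc ^ m`. -/
noncomputable def gramIntegral (m : ℕ) : ℝ := ∫ z : ℝ × ℝ, gramKernel m z.1 z.2

lemma integrable_sin_mul_dsinc {m : ℕ} (hm : 1 ≤ m) :
    Integrable fun t => Real.sin t * dsinc t * Real.sinc t ^ (2 * m) := by
  refine (integrable_sinc_pow_mul_dsinc_mul (by omega : 1 ≤ 2 * m) Real.continuous_sin
    Real.abs_sin_le_one).congr (Filter.Eventually.of_forall fun t => ?_)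
  simp only
  ring

/-- Since sin t = t sinc t, the integrand is t (sinc^{2m+2})' / (2m+2); integrate by parts. -/
lemma integral_sin_mul_dsinc {m : ℕ} (hm : 1 ≤ m) :
    ∫ t, Real.sin t * dsinc t * Real.sinc t ^ (2 * m) =
      -(sincI (m + 1) / (2 * (m + 1))) := by
  have h := integral_mul_deriv_eq_deriv_mul_of_integrable
    (u := fun t : ℝ => t) (u' := fun _ => 1)
    (v := fun t => Real.sinc t ^ (2 * (m + 1)))
    (v' := fun t => (2 * (m + 1) : ℕ) * Real.sinc t ^ (2 * (m + 1) - 1) * dsinc t)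
    (fun t _ => hasDerivAt_id t) (fun t _ => hasDerivAt_sinc_pow _ t)
    (by
      refine ((integrable_sin_mul_dsinc hm).const_mul ((2 * (m + 1) : ℕ) : ℝ)).congr
        (Filter.Eventually.of_forall fun t => ?_)
      simp only [Pi.mul_apply]
      rw [sin_eq_mul_sinc, show 2 * (m + 1) - 1 = 2 * m + 1 by omega]
      ring)
    (by
      refine (integrable_sinc_pow (by omega : 2 ≤ 2 * (m + 1))).congr
        (Filter.Eventually.of_forall fun t => ?_)
      simp only [Pi.mul_apply, one_mul])
    (by
      refine (integrable_sinc_pow_mul (by omega : 2 ≤ 2 * m + 1) Real.continuous_sin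
        Real.abs_sin_le_one).congr (Filter.Eventually.of_forall fun t => ?_)
      simp only [Pi.mul_apply]
      rw [sin_eq_mul_sinc]
      ring)
  simp only [one_mul] at h
  rw [← sincI] at h
  have h2 : ∫ t : ℝ, t * ((2 * (m + 1) : ℕ) * Real.sinc t ^ (2 * (m + 1) - 1) * dsinc t) =
      (2 * (m + 1)) * ∫ t, Real.sin t * dsinc t * Real.sinc t ^ (2 * m) := by
    rw [← integral_const_mul]
    congr 1
    ext t
    rw [sin_eq_mul_sinc, show 2 * (m + 1) - 1 = 2 * m + 1 by omega]
    push_cast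
    ring
  rw [h2] at h
  field_simp
  linarith

lemma gramKernel_expand (m : ℕ) (z : ℝ × ℝ) :
    gramKernel m z.1 z.2 =
      (Real.sinc z.1 ^ (2 * m) * dsinc z.1 ^ 2) * (Real.sin z.2 ^ 2 * Real.sinc z.2 ^ (2 * m)) +
      (Real.sin z.1 ^ 2 * Real.sinc z.1 ^ (2 * m)) * (Real.sinc z.2 ^ (2 * m) * dsinc z.2 ^ 2) -
      2 * ((Real.sin z.1 * dsinc z.1 * Real.sinc z.1 ^ (2 * m)) *
        (Real.sin z.2 * dsinc z.2 * Real.sinc z.2 ^ (2 * m))) := by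
  rw [gramKernel]
  ring

lemma integrable_gramKernel {m : ℕ} (hm : 1 ≤ m) :
    Integrable fun z : ℝ × ℝ => gramKernel m z.1 z.2 := by
  simp_rw [gramKernel_expand]
  have hJ := integrable_sin_sq_mul_sinc_pow (by omega : 2 ≤ 2 * m)
  have hK := integrable_sinc_pow_mul_dsinc_sq (2 * m)
  have hC := integrable_sin_mul_dsinc hm
  exact ((hK.mul_prod hJ).add (hJ.mul_prod hK)).sub ((hC.mul_prod hC).const_mul 2)

lemma gramIntegral_eq {m : ℕ} (hm : 1 ≤ m) :
    gramIntegral m = 2 * (sincJ (m + 1) * sincK (m + 1) -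
      (sincI (m + 1) / (2 * (m + 1))) ^ 2) := by
  have hJ := integrable_sin_sq_mul_sinc_pow (by omega : 2 ≤ 2 * m)
  have hK := integrable_sinc_pow_mul_dsinc_sq (2 * m)
  have hC := integrable_sin_mul_dsinc hm
  rw [gramIntegral]
  simp_rw [gramKernel_expand]
  rw [integral_sub, integral_add, integral_const_mul, Measure.volume_eq_prod,
    integral_prod_mul (fun t => Real.sinc t ^ (2 * m) * dsinc t ^ 2)
      (fun t => Real.sin t ^ 2 * Real.sinc t ^ (2 * m)),
    integral_prod_mul (fun t => Real.sin t ^ 2 * Real.sinc t ^ (2 * m))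
      (fun t => Real.sinc t ^ (2 * m) * dsinc t ^ 2),
    integral_prod_mul (fun t => Real.sin t * dsinc t * Real.sinc t ^ (2 * m))
      (fun t => Real.sin t * dsinc t * Real.sinc t ^ (2 * m)), integral_sin_mul_dsinc hm,
    sincJ, sincK, show 2 * (m + 1) - 2 = 2 * m by omega]
  · ring
  · exact hK.mul_prod hJ
  · exact hJ.mul_prod hK
  · exact (hK.mul_prod hJ).add (hJ.mul_prod hK)
  · exact (hC.mul_prod hC).const_mul 2

/-- The 1/4 is the Heisenberg bound, coming from the explicit inner product in the Gram determinant;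
the rest is the Cauchy–Schwarz defect. Here p = m + 1. -/
lemma uncertainty_eq_gramIntegral {m : ℕ} (hm : 1 ≤ m) :
    ((m + 1 : ℕ) : ℝ) ^ 2 * sincJ (m + 1) * sincK (m + 1) / sincI (m + 1) ^ 2 =
      1 / 4 + (m + 1) ^ 2 * gramIntegral m / (2 * sincI (m + 1) ^ 2) := by
  have hI := (sincI_pos (by omega : 1 ≤ m + 1)).ne'
  rw [gramIntegral_eq hm]
  push_cast
  field_simp
  ring

/-! ### Upper bound for the next Gram determinant -/

lemma sincI_one_le : sincI 1 ≤ 7 := by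
  have h : sincI 1 ≤ ∫ t : ℝ, 2 * (1 + t ^ 2)⁻¹ :=
    integral_mono (integrable_sinc_pow le_rfl) (integrable_inv_one_add_sq.const_mul 2) sinc_sq_le
  rw [integral_const_mul, integral_univ_inv_one_add_sq] at h
  linarith [Real.pi_lt_d2]

lemma sinc_sq_le_inv {s b : ℝ} (hb : 0 < b) (hs : b ≤ s ^ 2) : Real.sinc s ^ 2 ≤ b⁻¹ := by
  have h : s ^ 2 * Real.sinc s ^ 2 ≤ 1 := by
    rw [← mul_pow, ← sin_eq_mul_sinc]; exact Real.sin_sq_le_one s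
  rw [← one_div, le_div_iff₀ hb, mul_comm]
  exact (mul_le_mul_of_nonneg_right hs (sq_nonneg _)).trans h

lemma gramKernel_le (m : ℕ) (s t : ℝ) :
    gramKernel m s t ≤ (Real.sinc s ^ 2) ^ m * (Real.sinc t ^ 2) ^ m := by
  have h : (Real.sin t * dsinc s - Real.sin s * dsinc t) ^ 2 ≤ 1 := by
    rw [sq_le_one_iff_abs_le_one]
    calc _ ≤ |Real.sin t * dsinc s| + |Real.sin s * dsinc t| := abs_sub _ _
      _ ≤ 1 * (1 / 2) + 1 * (1 / 2) := by
        rw [abs_mul, abs_mul]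
        gcongr
        · exact Real.abs_sin_le_one t
        · exact abs_dsinc_le s
        · exact Real.abs_sin_le_one s
        · exact abs_dsinc_le t
      _ = 1 := by norm_num
  rw [gramKernel, mul_pow, pow_mul, pow_mul]
  exact mul_le_of_le_one_left (by positivity) h

lemma gramKernel_succ_le_of_sq_le {m : ℕ} {s t b : ℝ} (hb : 0 < b)
    (h : b ≤ s ^ 2 ∨ b ≤ t ^ 2) :
    gramKernel (m + 1) s t ≤ b⁻¹ ^ m * (Real.sinc s ^ 2 * Real.sinc t ^ 2) := by
  have h1 : ∀ x, Real.sinc x ^ 2 ≤ 1 := fun x =>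
    (sq_le_one_iff_abs_le_one _).2 (Real.abs_sinc_le_one x)
  have h2 : (Real.sinc s ^ 2) ^ m * (Real.sinc t ^ 2) ^ m ≤ b⁻¹ ^ m := by
    rcases h with h | h
    · calc _ ≤ b⁻¹ ^ m * 1 := by
            gcongr
            · exact sinc_sq_le_inv hb h
            · exact pow_le_one₀ (sq_nonneg _) (h1 t)
        _ = _ := mul_one _
    · calc _ ≤ 1 * b⁻¹ ^ m := by
            gcongr
            · exact pow_le_one₀ (sq_nonneg _) (h1 s)
            · exact sinc_sq_le_inv hb h
        _ = _ := one_mul _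
  refine (gramKernel_le _ s t).trans ?_
  calc _ = (Real.sinc s ^ 2) ^ m * (Real.sinc t ^ 2) ^ m *
        (Real.sinc s ^ 2 * Real.sinc t ^ 2) := by ring
    _ ≤ _ := by gcongr

/-- On a dilated box the kernel comparison gives c⁸, and the planar Jacobian c² makes it c¹⁰, the
fifth power of c². Off that box one coordinate has square at least c²·(3/8)π², so the kernel decays
geometrically in m; 49 bounds (∫ sinc²)². -/
lemma gramIntegral_succ_le {m : ℕ} (hm : 1 ≤ m) :
    gramIntegral (m + 1) ≤ (1 - 7 / (10 * ((m + 1 : ℕ) + 1)) : ℝ) ^ 5 * gramIntegral m +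
      49 * ((1 - 7 / (10 * ((m + 1 : ℕ) + 1))) * (3 / 8 * Real.pi ^ 2))⁻¹ ^ m := by
  set x : ℝ := 1 - 7 / (10 * ((m + 1 : ℕ) + 1)) with hx
  set A : ℝ := 3 / 8 * Real.pi ^ 2 with hA
  have hApos : 0 < A := by positivity
  have hx0 : 0 < x := by
    rw [hx, sub_pos, div_lt_one (by positivity)]
    push_cast
    linarith [m.cast_nonneg (α := ℝ)]
  set c := √x with hc
  have hc0 : 0 < c := Real.sqrt_pos.2 hx0
  have hc2 : c ^ 2 = x := Real.sq_sqrt hx0.le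
  set B : Set (ℝ × ℝ) := {z | z.1 ^ 2 ≤ A ∧ z.2 ^ 2 ≤ A} with hB
  have hBm : MeasurableSet B := by
    have h1 : MeasurableSet {z : ℝ × ℝ | z.1 ^ 2 ≤ A} :=
      measurableSet_le (by fun_prop) (by fun_prop)
    have h2 : MeasurableSet {z : ℝ × ℝ | z.2 ^ 2 ≤ A} :=
      measurableSet_le (by fun_prop) (by fun_prop)
    exact h1.inter h2
  have hcBm : MeasurableSet (c • B) := hBm.const_smul₀ c
  have hint := integrable_gramKernel hm
  have hint' := integrable_gramKernel (by omega : 1 ≤ m + 1)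
  have hcomp : ∫ z in B, gramKernel (m + 1) (c * z.1) (c * z.2) =
      (c ^ 2)⁻¹ * ∫ z in c • B, gramKernel (m + 1) z.1 z.2 := by
    have h := Measure.setIntegral_comp_smul_of_pos (volume : Measure (ℝ × ℝ))
      (fun z : ℝ × ℝ => gramKernel (m + 1) z.1 z.2) B hc0
    simpa using h
  have hint2 : IntegrableOn (fun z : ℝ × ℝ => gramKernel (m + 1) (c * z.1) (c * z.2)) B := by
    have := hint'.comp_smul (R := c) hc0.ne'
    exact this.integrableOn
  have hcore : ∫ z in c • B, gramKernel (m + 1) z.1 z.2 ≤ x ^ 5 * gramIntegral m := by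
    have h1 : ∫ z in B, gramKernel (m + 1) (c * z.1) (c * z.2) ≤
        ∫ z in B, c ^ 8 * gramKernel m z.1 z.2 :=
      setIntegral_mono_on hint2 (hint.integrableOn.const_mul _) hBm fun z hz =>
        gramKernel_succ_mul_le hc0 (by rw [hc2]) hz.1 hz.2
    have h2 : ∫ z in B, gramKernel m z.1 z.2 ≤ gramIntegral m :=
      setIntegral_le_integral hint (Filter.Eventually.of_forall fun z => gramKernel_nonneg m _ _)
    rw [hcomp, integral_const_mul, inv_mul_le_iff₀ (by positivity)] at h1
    calc _ ≤ c ^ 2 * (c ^ 8 * ∫ z in B, gramKernel m z.1 z.2) := h1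
      _ ≤ c ^ 2 * (c ^ 8 * gramIntegral m) := by gcongr
      _ = (c ^ 2) ^ 5 * gramIntegral m := by ring
      _ = _ := by rw [hc2]
  have hg2 : Integrable fun t : ℝ => Real.sinc t ^ 2 := integrable_sinc_pow le_rfl
  have htail : ∫ z in (c • B)ᶜ, gramKernel (m + 1) z.1 z.2 ≤ 49 * (x * A)⁻¹ ^ m := by
    have hprod := (hg2.mul_prod hg2).const_mul ((x * A)⁻¹ ^ m)
    calc _ ≤ ∫ z in (c • B)ᶜ, (x * A)⁻¹ ^ m * (Real.sinc z.1 ^ 2 * Real.sinc z.2 ^ 2) := by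
          refine setIntegral_mono_on hint'.integrableOn hprod.integrableOn hcBm.compl
            fun z hz => gramKernel_succ_le_of_sq_le (by positivity) ?_
          by_contra! hcon
          refine hz ((Set.mem_smul_set_iff_inv_smul_mem₀ hc0.ne' _ _).2 ?_)
          simp only [hB, Set.mem_ofPred_eq, Prod.smul_fst, Prod.smul_snd, smul_eq_mul, mul_pow,
            inv_pow, hc2]
          rw [inv_mul_le_iff₀ hx0, inv_mul_le_iff₀ hx0]
          exact ⟨hcon.1.le, hcon.2.le⟩
      _ ≤ ∫ z : ℝ × ℝ, (x * A)⁻¹ ^ m * (Real.sinc z.1 ^ 2 * Real.sinc z.2 ^ 2) :=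
          setIntegral_le_integral hprod (Filter.Eventually.of_forall fun z => by positivity)
      _ = (x * A)⁻¹ ^ m * (sincI 1 * sincI 1) := by
          rw [integral_const_mul, Measure.volume_eq_prod,
            integral_prod_mul (fun t => Real.sinc t ^ 2) (fun t => Real.sinc t ^ 2)]
          rfl
      _ ≤ (x * A)⁻¹ ^ m * (7 * 7) := by
          have := sincI_one_le
          have := (sincI_pos le_rfl).le
          gcongr
      _ = _ := by ring
  have hsplit := integral_add_compl hcBm hint'
  rw [← gramIntegral] at hsplit
  linarith

/-! ### Lower bounds for the Gram determinant and for I -/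

lemma le_sinc (s : ℝ) : 1 - s ^ 2 / 6 ≤ Real.sinc s := by
  wlog h : 0 ≤ s generalizing s
  · have := this (-s) (by linarith)
    rwa [Real.sinc_neg, neg_sq] at this
  rcases h.eq_or_lt with rfl | h
  · simp
  rw [Real.sinc_of_ne_zero h.ne', le_div_iff₀ h]
  have := Real.sin_ge_sub_cube h.le
  linarith

/-- Here sinc(√p s) ≤ sinc(s)^p, by the Euler product comparison. -/
lemma sinc_le_sinc_sqrt_pow {s : ℝ} {p : ℕ} (hp : 0 < p) (hs : p * s ^ 2 ≤ Real.pi ^ 2) :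
    1 - p * s ^ 2 / 6 ≤ Real.sinc s ^ p := by
  have h := sinc_pow_le_of_mul_sq_eq (s := √p * s) (t := s) (m := 1) hp hp
    (by rwa [mul_pow, Real.sq_sqrt (by positivity)])
    (by rw [mul_pow, Real.sq_sqrt (by positivity), Nat.cast_one, one_mul])
  rw [pow_one] at h
  refine le_trans ?_ h
  have := le_sinc (√p * s)
  rwa [mul_pow, Real.sq_sqrt (by positivity)] at this

lemma le_gramIntegral {m : ℕ} (hm : 1 ≤ m) :
    1 / (200000 * (m + 1 : ℝ) ^ 5) ≤ gramIntegral m := by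
  have hpi := Real.pi_gt_three
  have hpi4 : Real.pi ^ 4 ≤ 98 := by
    have h1 := Real.pi_lt_d4
    calc Real.pi ^ 4 ≤ (3.1416 : ℝ) ^ 4 := by gcongr
      _ ≤ 98 := by norm_num
  set p : ℝ := m + 1 with hp
  have hp0 : 0 < p := by positivity
  set r : ℝ := √p⁻¹ with hr
  have hr0 : 0 < r := Real.sqrt_pos.2 (by positivity)
  have hr2 : p * r ^ 2 = 1 := by
    rw [hr, Real.sq_sqrt (by positivity), mul_inv_cancel₀ hp0.ne']
  -- A box at scale 1/√p, where sinc^p stays bounded below, kept away from the axes and the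
  -- diagonal, where the kernel vanishes.
  set S : Set (ℝ × ℝ) := Set.Icc (3 / 2 * r) (2 * r) ×ˢ Set.Icc (1 / 2 * r) r with hS
  have hSm : MeasurableSet S := measurableSet_Icc.prod measurableSet_Icc
  have hvol : volume.real S = 1 / 4 * r ^ 2 := by
    rw [hS, Measure.volume_eq_prod, measureReal_prod_prod, Real.volume_real_Icc_of_le (by linarith),
      Real.volume_real_Icc_of_le (by linarith)]
    ring
  have hfin : volume S ≠ ⊤ := by
    rw [hS, Measure.volume_eq_prod, Measure.prod_prod]
    simp [ENNReal.mul_eq_top]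
  have hbound : ∀ z ∈ S, 1 / 50000 * (r ^ 2) ^ 4 ≤ gramKernel m z.1 z.2 := by
    rintro ⟨s, t⟩ ⟨⟨hs1, hs2⟩, ⟨ht1, ht2⟩⟩
    simp only at hs1 hs2 ht1 ht2 ⊢
    have hs0 : 0 < s := by linarith
    have ht0 : 0 < t := by linarith
    have a1 : 9 / 4 * r ^ 2 ≤ s ^ 2 := by
      calc _ = (3 / 2 * r) ^ 2 := by ring
        _ ≤ _ := by gcongr
    have a2 : s ^ 2 ≤ 4 * r ^ 2 := by
      calc _ ≤ (2 * r) ^ 2 := by gcongr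
        _ = _ := by ring
    have a3 : 1 / 4 * r ^ 2 ≤ t ^ 2 := by
      calc _ = (1 / 2 * r) ^ 2 := by ring
        _ ≤ _ := by gcongr
    have a4 : t ^ 2 ≤ r ^ 2 := by gcongr
    have a5 : 5 / 4 * r ^ 2 ≤ s ^ 2 - t ^ 2 := by linarith
    have b1 : p * s ^ 2 ≤ 4 := by
      calc _ ≤ p * (4 * r ^ 2) := by gcongr
        _ = 4 * (p * r ^ 2) := by ring
        _ = 4 := by rw [hr2, mul_one]
    have b2 : p * t ^ 2 ≤ 1 := by
      calc _ ≤ p * (r ^ 2) := by gcongr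
        _ = 1 := hr2
    have hpc : ((m + 1 : ℕ) : ℝ) = p := by push_cast; rfl
    have c1 : 1 / 3 ≤ Real.sinc s ^ (m + 1) := by
      have := sinc_le_sinc_sqrt_pow (s := s) (Nat.succ_pos m) (by
        rw [Nat.succ_eq_add_one, hpc]; nlinarith)
      rw [Nat.succ_eq_add_one, hpc] at this
      linarith
    have c2 : 5 / 6 ≤ Real.sinc t ^ (m + 1) := by
      have := sinc_le_sinc_sqrt_pow (s := t) (Nat.succ_pos m) (by
        rw [Nat.succ_eq_add_one, hpc]; nlinarith)
      rw [Nat.succ_eq_add_one, hpc] at this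
      linarith
    have hp1 : 1 ≤ p := by rw [hp]; linarith [m.cast_nonneg (α := ℝ)]
    have hspi : s ^ 2 < Real.pi ^ 2 := by nlinarith
    refine le_trans ?_ (le_gramKernel hspi (by linarith [sq_nonneg r]))
    rw [mul_comm 2 (m + 1), pow_mul, mul_pow]
    have a6 : 0 ≤ 2 * (s ^ 2 - t ^ 2) := by linarith [sq_nonneg r]
    calc 1 / 50000 * (r ^ 2) ^ 4 ≤ (9 / 4 * r ^ 2) * (1 / 4 * r ^ 2) *
          (2 * (5 / 4 * r ^ 2) / 98) ^ 2 * (1 / 3 * (5 / 6)) ^ 2 := by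
          have : 0 ≤ (r ^ 2) ^ 4 := by positivity
          nlinarith
      _ ≤ _ := by gcongr
  have h1 : 1 / 50000 * (r ^ 2) ^ 4 * volume.real S ≤ ∫ z in S, gramKernel m z.1 z.2 :=
    setIntegral_ge_of_const_le_real hSm hfin hbound (integrable_gramKernel hm).integrableOn
  have h2 : ∫ z in S, gramKernel m z.1 z.2 ≤ gramIntegral m :=
    setIntegral_le_integral (integrable_gramKernel hm)
      (Filter.Eventually.of_forall fun z => gramKernel_nonneg m _ _)
  refine le_trans (le_of_eq ?_) (h1.trans h2)
  have hrp : r ^ 2 = 1 / p := by rw [eq_div_iff hp0.ne', mul_comm]; exact hr2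
  rw [hvol, hrp]
  field_simp
  norm_num

lemma le_sincI {p : ℕ} (hp : 1 ≤ p) : 1 / (2 * (p : ℝ)) ≤ sincI p := by
  have hp0 : (1 : ℝ) ≤ p := by exact_mod_cast hp
  have hpi := Real.pi_gt_three
  have hnn : ∀ t, 0 ≤ Real.sinc t ^ (2 * p) := fun t => by rw [pow_mul]; positivity
  have hint := integrable_sinc_pow (by omega : 2 ≤ 2 * p)
  have h1 : 25 / 36 * volume.real (Set.Icc 0 (1 / (p : ℝ))) ≤
      ∫ t in Set.Icc 0 (1 / (p : ℝ)), Real.sinc t ^ (2 * p) := by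
    refine setIntegral_ge_of_const_le_real measurableSet_Icc (by simp) (fun t ht => ?_)
      hint.integrableOn
    have ht2 : p * t ^ 2 ≤ 1 := by
      calc _ ≤ p * (1 / (p : ℝ)) ^ 2 := by
            have := ht.1
            have := ht.2
            gcongr
        _ = 1 / p := by field_simp
        _ ≤ 1 := by rw [div_le_one (by linarith)]; exact hp0
    have := sinc_le_sinc_sqrt_pow (s := t) (by omega : 0 < p) (by nlinarith)
    rw [mul_comm, pow_mul]
    nlinarith
  have h2 := setIntegral_le_integral (s := Set.Icc 0 (1 / (p : ℝ))) hint
    (Filter.Eventually.of_forall hnn)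
  rw [Real.volume_real_Icc_of_le (by positivity), sub_zero] at h1
  rw [← sincI] at h2
  refine le_trans ?_ (h1.trans h2)
  rw [show 1 / (2 * (p : ℝ)) = 1 / 2 * (1 / p) by field_simp]
  exact mul_le_mul_of_nonneg_right (by norm_num) (by positivity)

/-- Substitute s ↦ μs with μ² = p/(p+1) on |s| ≤ π, where sinc(s)^{2p} ≤ sinc(μs)^{2p+2}. Outside,
sinc² ≤ 1/9 because π > 3. -/
lemma le_sincI_succ {p : ℕ} (hp : 1 ≤ p) :
    √((p : ℝ) / (p + 1)) * (sincI p - 7 * (1 / 9) ^ (p - 1)) ≤ sincI (p + 1) := by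
  have hp0 : (0 : ℝ) < p := by exact_mod_cast hp
  have hpi := Real.pi_gt_three
  set μ := √((p : ℝ) / (p + 1)) with hμ
  have hμ0 : 0 < μ := Real.sqrt_pos.2 (by positivity)
  have hμ2 : μ ^ 2 = p / (p + 1) := Real.sq_sqrt (by positivity)
  set B : Set ℝ := {s | s ^ 2 ≤ Real.pi ^ 2} with hB
  have hBm : MeasurableSet B := measurableSet_le (by fun_prop) (by fun_prop)
  have hint := integrable_sinc_pow (by omega : 2 ≤ 2 * p)
  have hint' := integrable_sinc_pow (by omega : 2 ≤ 2 * (p + 1))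
  have hcomp : ∫ s in B, Real.sinc (μ * s) ^ (2 * (p + 1)) =
      μ⁻¹ * ∫ s in μ • B, Real.sinc s ^ (2 * (p + 1)) := by
    have h := Measure.setIntegral_comp_smul_of_pos (volume : Measure ℝ)
      (fun s => Real.sinc s ^ (2 * (p + 1))) B hμ0
    simpa using h
  have h1 : ∫ s in B, Real.sinc s ^ (2 * p) ≤ ∫ s in B, Real.sinc (μ * s) ^ (2 * (p + 1)) := by
    refine setIntegral_mono_on hint.integrableOn
      (hint'.comp_mul_left' hμ0.ne').integrableOn hBm fun s hs => ?_
    refine sinc_pow_le_of_mul_sq_eq (by omega) (by omega) hs ?_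
    rw [mul_pow, hμ2]
    push_cast
    field_simp
  have h2 : ∫ s in μ • B, Real.sinc s ^ (2 * (p + 1)) ≤ sincI (p + 1) :=
    setIntegral_le_integral hint' (Filter.Eventually.of_forall fun s => by
      simp only [Pi.zero_apply]
      rw [pow_mul]
      positivity)
  have h3 : ∫ s in Bᶜ, Real.sinc s ^ (2 * p) ≤ 7 * (1 / 9) ^ (p - 1) := by
    have hi := (integrable_sinc_pow le_rfl).const_mul ((1 / 9 : ℝ) ^ (p - 1))
    calc _ ≤ ∫ s in Bᶜ, (1 / 9 : ℝ) ^ (p - 1) * Real.sinc s ^ 2 := by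
          refine setIntegral_mono_on hint.integrableOn hi.integrableOn hBm.compl fun s hs => ?_
          have hs' : 9 ≤ s ^ 2 := by
            have : Real.pi ^ 2 < s ^ 2 := not_le.1 hs
            nlinarith
          have h9 := sinc_sq_le_inv (by norm_num : (0 : ℝ) < 9) hs'
          calc _ = (Real.sinc s ^ 2) ^ (p - 1) * Real.sinc s ^ 2 := by
                rw [← pow_succ, Nat.sub_add_cancel hp, pow_mul]
            _ ≤ _ := by
                gcongr
                rwa [one_div]
      _ ≤ ∫ s, (1 / 9 : ℝ) ^ (p - 1) * Real.sinc s ^ 2 :=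
          setIntegral_le_integral hi (Filter.Eventually.of_forall fun s => by positivity)
      _ = (1 / 9 : ℝ) ^ (p - 1) * sincI 1 := by rw [integral_const_mul]; rfl
      _ ≤ (1 / 9 : ℝ) ^ (p - 1) * 7 := by gcongr; exact sincI_one_le
      _ = _ := mul_comm _ _
  have hsplit := integral_add_compl hBm hint
  rw [← sincI] at hsplit
  rw [hcomp, le_inv_mul_iff₀ hμ0] at h1
  refine le_trans ?_ (h1.trans h2)
  gcongr
  linarith

/-! ### Numerical comparison for p ≥ 40 -/

/-- The constant is 49 · 100 · 200000: the tail constant, the allowed relative error 1/(100p), and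
the lower bound for the Gram integral. -/
lemma pow_mul_two_sevenths_pow_le {m : ℕ} (hm : 39 ≤ m) :
    980000000 * (m + 1 : ℝ) ^ 6 * (2 / 7) ^ m ≤ 1 := by
  induction m, hm using Nat.le_induction with
  | base => norm_num
  | succ k hk ih =>
    refine le_trans ?_ ih
    have hk' : (39 : ℝ) ≤ k := by exact_mod_cast hk
    have h : ((k + 1 : ℕ) + 1 : ℝ) ^ 6 ≤ 7 / 2 * (k + 1 : ℝ) ^ 6 := by
      calc ((k + 1 : ℕ) + 1 : ℝ) ^ 6 ≤ (41 / 40 * (k + 1 : ℝ)) ^ 6 := by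
            gcongr
            push_cast
            linarith
        _ = (41 / 40) ^ 6 * (k + 1 : ℝ) ^ 6 := by ring
        _ ≤ _ := by gcongr; norm_num
    calc _ ≤ 980000000 * (7 / 2 * (k + 1 : ℝ) ^ 6) * (2 / 7) ^ (k + 1) := by gcongr
      _ = _ := by ring

lemma dilation_polynomial_lt {p : ℝ} (hp : 40 ≤ p) :
    (p + 1) ^ 2 * ((1 - 7 / (10 * (p + 1))) ^ 5 + 1 / (100 * p)) <
      p ^ 2 * (p / (p + 1) * (1 - 1 / (100 * p)) ^ 2) := by
  -- After shifting by 40 and clearing denominators, the difference is a polynomial in k whose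
  -- positivity is visible from its coefficients.
  obtain ⟨k, hk, rfl⟩ : ∃ k, 0 ≤ k ∧ p = 40 + k := ⟨p - 40, by linarith, by ring⟩
  have h1 : (1 - 7 / (10 * (40 + k + 1))) = (40 + k + 3 / 10) / (40 + k + 1) := by
    field_simp; ring
  have h2 : (1 - 1 / (100 * (40 + k))) = (40 + k - 1 / 100) / (40 + k) := by
    field_simp
  rw [h1, h2]
  have e1 : (40 + k + 1) ^ 2 * (((40 + k + 3 / 10) / (40 + k + 1)) ^ 5 + 1 / (100 * (40 + k))) =
      ((40 + k + 3 / 10) ^ 5 * (40 + k) + (40 + k + 1) ^ 5 / 100) /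
        ((40 + k + 1) ^ 3 * (40 + k)) := by
    field_simp
  have e2 : (40 + k) ^ 2 * ((40 + k) / (40 + k + 1) * ((40 + k - 1 / 100) / (40 + k)) ^ 2) =
      ((40 + k) ^ 2 * (40 + k + 1) ^ 2 * (40 + k - 1 / 100) ^ 2) /
        ((40 + k + 1) ^ 3 * (40 + k)) := by
    field_simp
  rw [e1, e2]
  refine div_lt_div_of_pos_right ?_ (by positivity)
  rw [← sub_pos]
  ring_nf
  positivity

lemma gram_ratio_lt {p N N' I I' : ℝ} (hp : 40 ≤ p) (hN : 0 < N) (hI : 0 < I)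
    (hN' : N' ≤ (1 - 7 / (10 * (p + 1))) ^ 5 * N + 1 / (100 * p) * N)
    (hI' : √(p / (p + 1)) * (I * (1 - 1 / (100 * p))) ≤ I') :
    (p + 1) ^ 2 * N' / (2 * I' ^ 2) < p ^ 2 * N / (2 * I ^ 2) := by
  have hp0 : 0 < p := by linarith
  have h1 : 0 < 1 - 1 / (100 * p) := by
    rw [sub_pos, div_lt_one (by positivity)]; linarith
  have hs : 0 < √(p / (p + 1)) := Real.sqrt_pos.2 (by positivity)
  have hI'0 : 0 < I' := lt_of_lt_of_le (by positivity) hI'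
  have hsq : p / (p + 1) * (1 - 1 / (100 * p)) ^ 2 * I ^ 2 ≤ I' ^ 2 := by
    calc _ = (√(p / (p + 1)) * (I * (1 - 1 / (100 * p)))) ^ 2 := by
          rw [mul_pow, Real.sq_sqrt (by positivity)]; ring
      _ ≤ _ := by gcongr
  rw [div_lt_div_iff₀ (by positivity) (by positivity)]
  calc (p + 1) ^ 2 * N' * (2 * I ^ 2) ≤ (p + 1) ^ 2 *
        ((1 - 7 / (10 * (p + 1))) ^ 5 * N + 1 / (100 * p) * N) * (2 * I ^ 2) := by gcongr
    _ = (p + 1) ^ 2 * ((1 - 7 / (10 * (p + 1))) ^ 5 + 1 / (100 * p)) * (2 * (N * I ^ 2)) := by ring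
    _ < p ^ 2 * (p / (p + 1) * (1 - 1 / (100 * p)) ^ 2) * (2 * (N * I ^ 2)) :=
        mul_lt_mul_of_pos_right (dilation_polynomial_lt hp) (by positivity)
    _ = p ^ 2 * N * (2 * (p / (p + 1) * (1 - 1 / (100 * p)) ^ 2 * I ^ 2)) := by ring
    _ ≤ _ := by gcongr

lemma inv_dilated_box_le {p : ℝ} (hp : 40 ≤ p) :
    ((1 - 7 / (10 * (p + 1))) * (3 / 8 * Real.pi ^ 2))⁻¹ ≤ 2 / 7 := by
  have h1 : 98 / 100 ≤ 1 - 7 / (10 * (p + 1)) := by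
    rw [le_sub_comm, div_le_iff₀ (by linarith)]
    linarith
  have h2 : (9.8 : ℝ) ≤ Real.pi ^ 2 := by nlinarith [Real.pi_gt_d2]
  have h3 : (7 / 2 : ℝ) ≤ (1 - 7 / (10 * (p + 1))) * (3 / 8 * Real.pi ^ 2) := by
    calc (7 / 2 : ℝ) ≤ 98 / 100 * (3 / 8 * 9.8) := by norm_num
      _ ≤ _ := by gcongr
  calc _ ≤ (7 / 2 : ℝ)⁻¹ := by gcongr
    _ = _ := by norm_num

/-- Both tails are shown to be at most 1/(100p) of the corresponding main quantity, as
`gram_ratio_lt` requires. -/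
lemma uncertainty_succ_lt_of_large {m : ℕ} (hm : 39 ≤ m) :
    ((m + 2 : ℕ) : ℝ) ^ 2 * sincJ (m + 2) * sincK (m + 2) / sincI (m + 2) ^ 2 <
      ((m + 1 : ℕ) : ℝ) ^ 2 * sincJ (m + 1) * sincK (m + 1) / sincI (m + 1) ^ 2 := by
  rw [uncertainty_eq_gramIntegral (m := m + 1) (by omega),
    uncertainty_eq_gramIntegral (m := m) (by omega)]
  refine add_lt_add_right ?_ _
  have hp : (40 : ℝ) ≤ (m + 1 : ℕ) := by exact_mod_cast (by omega : 40 ≤ m + 1)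
  have hI := sincI_pos (by omega : 1 ≤ m + 1)
  have hN := le_gramIntegral (by omega : 1 ≤ m)
  have hIle := le_sincI (by omega : 1 ≤ m + 1)
  have hsmall := pow_mul_two_sevenths_pow_le hm
  have hcast : (m + 1 : ℝ) = ((m + 1 : ℕ) : ℝ) := by push_cast; rfl
  rw [hcast] at hN hsmall ⊢
  have hupper := gramIntegral_succ_le (by omega : 1 ≤ m)
  have hlower := le_sincI_succ (by omega : 1 ≤ m + 1)
  rw [Nat.add_sub_cancel] at hlower
  generalize ((m + 1 : ℕ) : ℝ) = p at *
  have hp0 : 0 < p := by linarith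
  have hN0 : 0 < gramIntegral m := lt_of_lt_of_le (by positivity) hN
  refine gram_ratio_lt hp hN0 hI (hupper.trans ?_) (le_trans ?_ hlower)
  · have hx0 : 0 ≤ ((1 - 7 / (10 * (p + 1))) * (3 / 8 * Real.pi ^ 2))⁻¹ := by
      have : 0 ≤ 1 - 7 / (10 * (p + 1)) := by
        rw [sub_nonneg, div_le_one (by linarith)]; linarith
      positivity
    refine add_le_add le_rfl ?_
    calc _ ≤ 49 * (2 / 7 : ℝ) ^ m := by gcongr; exact inv_dilated_box_le hp
      _ ≤ 1 / (100 * p) * (1 / (200000 * p ^ 5)) := by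
        rw [div_mul_div_comm, le_div_iff₀ (by positivity)]
        calc _ = 980000000 * p ^ 6 * (2 / 7 : ℝ) ^ m := by ring
          _ ≤ _ := by linarith
      _ ≤ _ := by gcongr
  · refine mul_le_mul_of_nonneg_left ?_ (Real.sqrt_nonneg _)
    have h1 : 7 * (1 / 9 : ℝ) ^ m ≤ sincI (m + 1) * (1 / (100 * p)) := by
      calc 7 * (1 / 9 : ℝ) ^ m ≤ 7 * (2 / 7 : ℝ) ^ m := by gcongr <;> norm_num
        _ ≤ 1 / (2 * p) * (1 / (100 * p)) := by
          rw [div_mul_div_comm, le_div_iff₀ (by positivity)]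
          have hp2 : p ^ 2 ≤ p ^ 6 := pow_le_pow_right₀ (by linarith) (by norm_num)
          have h27 : (0 : ℝ) < (2 / 7) ^ m := by positivity
          calc _ = 1400 * p ^ 2 * (2 / 7 : ℝ) ^ m := by ring
            _ ≤ 980000000 * p ^ 6 * (2 / 7 : ℝ) ^ m := by gcongr; norm_num
            _ ≤ _ := by linarith
        _ ≤ _ := by gcongr
    linarith

/-! ### Strict decrease for all p -/

lemma uncertainty_succ_lt {p : ℕ} (hp : 2 ≤ p) :
    ((p + 1 : ℕ) : ℝ) ^ 2 * sincJ (p + 1) * sincK (p + 1) / sincI (p + 1) ^ 2 <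
      (p : ℝ) ^ 2 * sincJ p * sincK p / sincI p ^ 2 := by
  rcases lt_or_ge p 40 with h | h
  · rw [uncertainty_eq_rectUncertaintyRat hp, uncertainty_eq_rectUncertaintyRat (by omega)]
    exact_mod_cast rectUncertaintyRat_succ_lt p (Finset.mem_Ico.2 ⟨hp, h⟩)
  · obtain ⟨m, rfl⟩ := Nat.exists_eq_add_of_le' (by omega : 1 ≤ p)
    exact uncertainty_succ_lt_of_large (by omega)

lemma rectUncertainty_succ_lt {p : ℕ} (hp : 2 ≤ p) :
    rectUncertainty (p + 1) < rectUncertainty p := by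
  rw [rectUncertainty_eq hp, rectUncertainty_eq (by omega)]
  have h := uncertainty_succ_lt hp
  refine (ENNReal.ofReal_lt_ofReal_iff (lt_of_le_of_lt ?_ h)).2 h
  have hJ : 0 ≤ sincJ (p + 1) := integral_nonneg fun t => by
    rw [Pi.zero_apply, show 2 * (p + 1) - 2 = 2 * p by omega, pow_mul]
    positivity
  have hK := sincK_nonneg (p + 1)
  positivity

theorem mainTheorem7 :
    StrictAntiOn rectUncertainty {p : ℕ | 2 ≤ p} := by
  intro p hp q _ hpq
  induction q, Nat.succ_le_of_lt hpq using Nat.le_induction with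
  | base => exact rectUncertainty_succ_lt hp
  | succ k hk ih =>
    have hk2 : 2 ≤ k := le_trans hp (by omega)
    exact (rectUncertainty_succ_lt hk2).trans (ih hk2 (by omega))
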